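/- Let $N\ge 1$, let $[N]=\{1,\dots,N\}$, and let $F=\big(e^{2\pi i (j-1)(k-1)/N}\big)_{j,k=1}^{N}\in\mathbb{C}^{N\times N}$ be the Fourier matrix. For nonempty $S,T\subset[N]$ let $F_{S,T}$ be the $|S|\times|T|$ submatrix of $F$ with rows indexed by $S$ and columns indexed by $T$, and let $\kappa(F_{S,T})=\sigma_1(F_{S,T})/\sigma_{\min(|S|,|T|)}(F_{S,T})$ be its condition number, where $\sigma_1\ge\sigma_2\ge\cdots$ are the singular values. A subset of $[N]$ is called cyclically contiguous if it equals a set of consecutive integers modulo $N$. Let $G=\sum_{k=0}^{\infty}\frac{(-1)^k}{(2k+1)^2}$ be Catalan's constant. There is an absolute constant $C$ such that for every $N\ge 1$, every nonempty subset $S\subset[N]$ and every nonempty cyclically contiguous subset $T\subset[N]$ the following hold. 1. $\sigma_{\min(|S|,|T|)}(F_{S,T})>0$, so that $\kappa(F_{S,T})$ is finite, and $$\log\kappa(F_{S,T})\le\frac{2GN}{\pi}+C.$$ 2. If $S$ is also cyclically contiguous, then $$\log\kappa(F_{S,T})\le\frac{2GN}{\pi}-\frac12\log N+C.$$ 3.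 If $S$ is also cyclically contiguous and $|S|=|T|=\lceil N/2\rceil$, then equality holds in part 2 up to a bounded error: $$\left|\log\kappa(F_{S,T})-\left(\frac{2GN}{\pi}-\frac12\log N\right)\right|\le C.$$ -/

import Mathlib

/-- The `k`-th singular value `σ_{k+1}` (counted from `0`, in non-increasing order, with multiplicity)
of a complex `m × n` matrix, with respect to the Euclidean inner products: the square root of an
eigenvalue of `Aᴴ A`. -/
noncomputable def matrixSingularValue {m n : Type*} [Fintype m] [Fintype n] [DecidableEq n]
    (A : Matrix m n ℂ) (k : ℕ) : ℝ :=
  (Matrix.toEuclideanLin A).singularValues k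

/-- The largest singular value `σ_1(A)`. -/
noncomputable def sigmaMax {m n : Type*} [Fintype m] [Fintype n] [DecidableEq n]
    (A : Matrix m n ℂ) : ℝ :=
  matrixSingularValue A 0

/-- The singular value `σ_{min(m, n)}(A)` of a nonempty `m × n` matrix. -/
noncomputable def sigmaMin {m n : Type*} [Fintype m] [Fintype n] [DecidableEq n]
    (A : Matrix m n ℂ) : ℝ :=
  matrixSingularValue A (min (Fintype.card m) (Fintype.card n) - 1)

/-- The condition number `κ(A) = σ_1(A) / σ_{min(m, n)}(A)`; it is finite iff `0 < sigmaMin A`. -/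
noncomputable def condNumber {m n : Type*} [Fintype m] [Fintype n] [DecidableEq n]
    (A : Matrix m n ℂ) : ℝ :=
  sigmaMax A / sigmaMin A

/-- The `N × N` Fourier matrix, with rows and columns indexed by `0, …, N - 1`. -/
noncomputable def fourierMatrix (N : ℕ) : Matrix (Fin N) (Fin N) ℂ :=
  Matrix.of fun j k =>
    Complex.exp (2 * (Real.pi : ℂ) * Complex.I * ((j : ℕ) : ℂ) * ((k : ℕ) : ℂ) / (N : ℂ))

/-- The submatrix `F_{S,T}` of the Fourier matrix with rows in `S` and columns in `T`. -/
noncomputable def fourierSubmatrix {N : ℕ} (S T : Finset (Fin N)) : Matrix S T ℂ :=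
  (fourierMatrix N).submatrix (fun j => (j : Fin N)) (fun k => (k : Fin N))

/-- `S` is the set of residues modulo `N` of consecutive integers `a, a + 1, …, a + m - 1`. -/
def IsCyclicallyContiguous {N : ℕ} (S : Finset (Fin N)) : Prop :=
  ∃ a m : ℕ, ∀ x : Fin N, x ∈ S ↔ ∃ i < m, (x : ℕ) ≡ a + i [MOD N]

/-- Catalan's constant `G = ∑ (-1)^k / (2k+1)^2`, an absolutely convergent series. -/
noncomputable def catalanConstant : ℝ :=
  ∑' k : ℕ, (-1 : ℝ) ^ k / (2 * (k : ℝ) + 1) ^ 2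

/-! Since `T` is an arc of residues, the image of a vector under the columns in `T` is, up to
unimodular factors, the list of values at roots of unity of a polynomial of degree `< |T|`. After
shrinking `S` and `T` to a common size `n` (`sqrt_div_le_sigmaMin`), Lagrange interpolation from the
nodes in `S` gives the values at all `N` nodes. Parseval turns this into `σ_min² ≥ N / (1 + ∑
|ℓ_z(w)|²)`, the sum over `z ∈ S`, `w ∉ S` (`card_mul_sum_norm_sq_le`), while `σ_max ≤ √N`.

Because the distances from one root of unity to all the others multiply to `N`, `|ℓ_z(w)|` is `1/N`
times the product of the distances from `w` to `S \ {z}` and from `z` to `Sᶜ` (`lagrangeWeight_eq`).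
The log of a distance is `log 2 / 2 + u(l/N)`, where `l` is the offset and `u(x) = log (√2 sin πx)`.
A sum of `u` over any set of offsets is at most the sum of its positive part, which is `N (G/π - log
2 / 4) + O(1)` because `u > 0` exactly on the middle half of the circle. In the product of the two
factors the `log 2` terms cancel, so `|ℓ_z(w)| ≤ (4/N) E` with `E = exp (2GN/π)`. Summing over at
most `N²` pairs proves part 1.

What the bound loses is recorded by `deficiency`. If `S` is an arc, the deficiency grows
quadratically in the distance of the offset of the arc from its optimal position, so both sums of
`exp (-2 deficiency)` are Gaussian and `O(√N)` instead of `N`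
(`sum_exp_neg_deficiency_erase_finArc_le`). This gains a factor `N` in `σ_min²`, hence `½ log N` in
part 2.

For part 3 there are about `√N` points `w` and `√N` points `z` with bounded deficiency. On an arc
the numbers `ℓ_z(w)` can be aligned by phases depending on `z` only, and a test polynomial carrying
these phases on the good `z` shows that nothing is lost (`sigmaMin_sq_mul_window_le`). -/

/-! ### Variational bounds for singular values. -/

section SingularValues

open Module InnerProductSpace

variable {E F : Type*} [NormedAddCommGroup E] [InnerProductSpace ℂ E] [FiniteDimensional ℂ E]
  [NormedAddCommGroup F] [InnerProductSpace ℂ F] [FiniteDimensional ℂ F]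

/-- Expand `⟪x, A* A x⟫` in an orthonormal eigenbasis of `A* A`. The variational bounds below are
all read off from this identity. -/
theorem LinearMap.norm_apply_sq_eq_sum_singularValues (A : E →ₗ[ℂ] F) {n : ℕ}
    (hn : finrank ℂ E = n) (x : E) :
    ‖A x‖ ^ 2 = ∑ i : Fin n, A.singularValues i ^ 2 *
      ‖inner ℂ (A.isSymmetric_adjoint_comp_self.eigenvectorBasis hn i) x‖ ^ 2 := by
  set hs := A.isSymmetric_adjoint_comp_self
  set b := hs.eigenvectorBasis hn
  have h1 : ((‖A x‖ ^ 2 : ℝ) : ℂ) = inner ℂ x ((LinearMap.adjoint A ∘ₗ A) x) := by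
    rw [LinearMap.comp_apply, LinearMap.adjoint_inner_right, inner_self_eq_norm_sq_to_K]
    simp
  have h2 : ∀ i, inner ℂ (b i) ((LinearMap.adjoint A ∘ₗ A) x)
      = (hs.eigenvalues hn i : ℂ) * inner ℂ (b i) x := by
    intro i
    rw [← hs (b i) x, hs.apply_eigenvectorBasis hn i, inner_smul_left]
    simp
    exact Or.inl rfl
  rw [← b.sum_inner_mul_inner] at h1
  apply Complex.ofReal_injective
  rw [h1, Complex.ofReal_sum]
  refine Finset.sum_congr rfl fun i _ => ?_
  rw [h2, A.sq_singularValues_fin hn i, ← inner_conj_symm x (b i)]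
  push_cast
  rw [← Complex.mul_conj', mul_left_comm, mul_comm (starRingEnd ℂ _)]

theorem LinearMap.norm_apply_le_singularValues_zero (A : E →ₗ[ℂ] F) (x : E) :
    ‖A x‖ ≤ A.singularValues 0 * ‖x‖ := by
  refine le_of_sq_le_sq ?_ (mul_nonneg (A.singularValues_nonneg 0) (norm_nonneg x))
  rw [A.norm_apply_sq_eq_sum_singularValues rfl, mul_pow,
    ← (A.isSymmetric_adjoint_comp_self.eigenvectorBasis rfl).sum_sq_norm_inner_right x,
    Finset.mul_sum]
  gcongr with i
  · exact A.singularValues_nonneg _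
  · exact A.singularValues_antitone (Nat.zero_le _)

theorem LinearMap.singularValues_le_of_norm_apply_le (A : E →ₗ[ℂ] F) {B : ℝ} (hB : 0 ≤ B)
    (h : ∀ x, ‖A x‖ ≤ B * ‖x‖) (k : ℕ) : A.singularValues k ≤ B := by
  by_cases hk : k < finrank ℂ E
  · set b := A.isSymmetric_adjoint_comp_self.eigenvectorBasis (n := finrank ℂ E) rfl
    have h1 := A.norm_apply_sq_eq_sum_singularValues rfl (b ⟨k, hk⟩)
    rw [Finset.sum_eq_single ⟨k, hk⟩] at h1
    · have h2 := h (b ⟨k, hk⟩)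
      rw [b.norm_eq_one, mul_one] at h2
      simp only [b] at h1 h2
      rw [OrthonormalBasis.inner_eq_one] at h1
      simp only [norm_one, one_pow, mul_one] at h1
      have := A.singularValues_nonneg k
      rw [sq_eq_sq₀ (norm_nonneg _) this] at h1
      linarith
    · intro i _ hi
      rw [OrthonormalBasis.inner_eq_zero _ hi]
      simp
    · simp
  · rw [A.singularValues_of_finrank_le (not_lt.mp hk)]
    exact hB

theorem LinearMap.singularValues_finrank_sub_one_mul_norm_le (A : E →ₗ[ℂ] F) (x : E) :
    A.singularValues (finrank ℂ E - 1) * ‖x‖ ≤ ‖A x‖ := by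
  refine le_of_sq_le_sq ?_ (norm_nonneg _)
  rw [A.norm_apply_sq_eq_sum_singularValues rfl, mul_pow,
    ← (A.isSymmetric_adjoint_comp_self.eigenvectorBasis rfl).sum_sq_norm_inner_right x,
    Finset.mul_sum]
  gcongr with i
  · exact A.singularValues_nonneg _
  · exact A.singularValues_antitone (by omega)

/-- The easy half of the Courant–Fischer min-max principle. -/
theorem LinearMap.le_singularValues_of_submodule (A : E →ₗ[ℂ] F) (W : Submodule ℂ E) {k : ℕ}
    (hk : k < finrank ℂ W) {b : ℝ} (hW : ∀ x ∈ W, b * ‖x‖ ≤ ‖A x‖) :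
    b ≤ A.singularValues k := by
  set n := finrank ℂ E with hn
  set e := A.isSymmetric_adjoint_comp_self.eigenvectorBasis (n := n) hn.symm
  -- As `dim W > k`, some nonzero vector of `W` is orthogonal to the first `k` singular vectors; on
  -- it `A` expands by at most the singular value of index `k`.
  let f : W →ₗ[ℂ] (Fin k → ℂ) :=
    LinearMap.pi fun i => (innerₛₗ ℂ (e ⟨i, i.2.trans (hk.trans_le W.finrank_le)⟩)).comp W.subtype
  obtain ⟨x, hx0, hxne⟩ : ∃ x : W, f x = 0 ∧ x ≠ 0 := by
    have := LinearMap.ker_ne_bot_of_finrank_lt (f := f) (by simpa using hk)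
    obtain ⟨x, hx, hne⟩ := (Submodule.ne_bot_iff _).mp this
    exact ⟨x, hx, hne⟩
  have hx : 0 < ‖(x : E)‖ := by simpa using hxne
  by_contra! hlt
  have h2 : ‖A x‖ ≤ A.singularValues k * ‖(x : E)‖ := by
    refine le_of_sq_le_sq ?_ (mul_nonneg (A.singularValues_nonneg _) (norm_nonneg _))
    rw [A.norm_apply_sq_eq_sum_singularValues hn.symm, mul_pow,
      ← e.sum_sq_norm_inner_right (x : E), Finset.mul_sum]
    refine Finset.sum_le_sum fun i _ => ?_
    by_cases hi : (i : ℕ) < k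
    · have : inner ℂ (e i) (x : E) = 0 := congrFun hx0 ⟨i, hi⟩
      simp only [e] at this ⊢
      simp [this]
    · gcongr
      · exact A.singularValues_nonneg _
      · exact A.singularValues_antitone (not_lt.mp hi)
  have h3 := hW x x.2
  nlinarith

end SingularValues

/-! ### Catalan's constant as a logarithmic integral. -/

section Catalan

open Real MeasureTheory intervalIntegral Filter Topology

theorem Real.one_add_two_mul_cos_add_sq_eq_normSq (r θ : ℝ) :
    1 + 2 * r * cos θ + r ^ 2 = ‖(1 + r * Complex.exp (θ * Complex.I) : ℂ)‖ ^ 2 := by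
  rw [← Complex.normSq_eq_norm_sq, Complex.exp_mul_I, Complex.normSq_apply]
  simp [← Complex.ofReal_cos, ← Complex.ofReal_sin]
  nlinarith [sin_sq_add_cos_sq θ]

/-- Real part of the series of `-log (1 - z)` at `z = -r e^{iθ}`; the term `n = 0` vanishes because
division by zero gives zero. -/
theorem hasSum_pow_mul_cos_div {r : ℝ} (hr : |r| < 1) (θ : ℝ) :
    HasSum (fun n : ℕ => (-r) ^ n / n * cos (n * θ)) (-(log (1 + 2 * r * cos θ + r ^ 2) / 2)) := by
  have hz : ‖(-(r * Complex.exp (θ * Complex.I)) : ℂ)‖ < 1 := by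
    simpa [Complex.norm_exp_ofReal_mul_I] using hr
  have h := Complex.hasSum_re (Complex.hasSum_taylorSeries_neg_log hz)
  convert h using 1
  · ext n
    have : (-(r * Complex.exp (θ * Complex.I)) : ℂ) ^ n / n =
        (((-r) ^ n / n : ℝ) : ℂ) * Complex.exp ((n * θ : ℝ) * Complex.I) := by
      rw [← neg_mul, mul_pow, ← Complex.exp_nat_mul]
      push_cast
      ring_nf
    rw [this, Complex.re_ofReal_mul, Complex.exp_ofReal_mul_I_re]
  · rw [one_add_two_mul_cos_add_sq_eq_normSq, log_pow, sub_neg_eq_add, Complex.neg_re,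
      Complex.log_re]
    push_cast
    ring

/-- Termwise integration produces `sin (nπ/2)`, which kills the even indices and supplies the
alternating signs of Catalan's series at the odd ones. -/
theorem hasSum_integral_log_one_add_two_mul_cos {r : ℝ} (hr : |r| < 1) :
    HasSum (fun j : ℕ => (-1 : ℝ) ^ j / (2 * (j : ℝ) + 1) ^ 2 * r ^ (2 * j + 1))
      (∫ θ in (0 : ℝ)..π / 2, log (1 + 2 * r * cos θ + r ^ 2) / 2) := by
  have h := intervalIntegral.hasSum_intervalIntegral_of_summable_norm (a := 0) (b := π / 2)
    (f := fun n : ℕ => (⟨fun θ => (-r) ^ n / n * cos (n * θ), by fun_prop⟩ : C(ℝ, ℝ)))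
    (by
      refine Summable.of_nonneg_of_le (fun _ => norm_nonneg _) (fun n => ?_)
        (summable_geometric_of_lt_one (abs_nonneg r) hr)
      rw [ContinuousMap.norm_le _ (by positivity)]
      intro x
      simp only [ContinuousMap.restrict_apply, ContinuousMap.coe_mk, norm_eq_abs, abs_mul, abs_div,
        abs_pow, abs_neg, Nat.abs_cast]
      have h1 : |r| ^ n / n ≤ |r| ^ n := by
        rcases Nat.eq_zero_or_pos n with rfl | hn
        · simp
        · exact div_le_self (by positivity) (by exact_mod_cast hn)
      calc _ ≤ |r| ^ n * 1 := by gcongr; exact abs_cos_le_one _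
        _ = _ := mul_one _)
  have h2 : ∀ n : ℕ, (∫ θ in (0 : ℝ)..π / 2, (-r) ^ n / n * cos (n * θ)) =
      (-r) ^ n / n ^ 2 * sin (n * (π / 2)) := by
    intro n
    rcases Nat.eq_zero_or_pos n with rfl | hn
    · simp
    · have : (n : ℝ) ≠ 0 := by positivity
      rw [intervalIntegral.integral_const_mul, intervalIntegral.integral_comp_mul_left _ this]
      simp
      field_simp
  simp only [ContinuousMap.coe_mk, h2] at h
  have h3 : (∫ θ in (0 : ℝ)..π / 2, ∑' n : ℕ, (-r) ^ n / n * cos (n * θ)) =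
      -∫ θ in (0 : ℝ)..π / 2, log (1 + 2 * r * cos θ + r ^ 2) / 2 := by
    rw [← intervalIntegral.integral_neg]
    congr 1
    ext θ
    exact (hasSum_pow_mul_cos_div hr θ).tsum_eq
  rw [h3] at h
  have h4 := h.neg
  rw [neg_neg] at h4
  have hinj : Function.Injective (fun j : ℕ => 2 * j + 1) := fun a b hab => by
    simpa using hab
  rw [← hinj.hasSum_iff] at h4
  · refine (congrArg (fun f => HasSum f _) (funext fun j => ?_)).mpr h4
    have : ((2 * j + 1 : ℕ) : ℝ) * (π / 2) = π / 2 + j * π := by push_cast; ring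
    simp only [Function.comp_apply, this, sin_add_nat_mul_pi, sin_pi_div_two]
    rw [Odd.neg_pow ⟨j, rfl⟩]
    push_cast
    ring
  · intro n hn
    rcases Nat.even_or_odd' n with ⟨k, rfl | rfl⟩
    · have : ((2 * k : ℕ) : ℝ) * (π / 2) = k * π := by push_cast; ring
      rw [this, sin_nat_mul_pi]
      simp
    · exact absurd ⟨k, rfl⟩ hn

theorem integral_log_two_add_two_mul_cos :
    ∫ θ in (0 : ℝ)..π / 2, log (2 + 2 * cos θ) / 2 = catalanConstant := by
  -- Abel limit `r → 1⁻`. The absolute value keeps the argument of `log` at least `1` for all `r`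
  -- and `θ`, so continuity in `r` needs no case analysis; on the relevant range it changes nothing.
  have hc : Continuous fun r : ℝ =>
      ∫ θ in (0 : ℝ)..π / 2, log (1 + |2 * r * cos θ| + r ^ 2) / 2 := by
    apply intervalIntegral.continuous_parametric_intervalIntegral_of_continuous'
    refine Continuous.div_const (Continuous.log (by fun_prop) fun x => ?_) _
    positivity
  have heq : ∀ r : ℝ, 0 ≤ r → (∫ θ in (0 : ℝ)..π / 2, log (1 + |2 * r * cos θ| + r ^ 2) / 2) =
      ∫ θ in (0 : ℝ)..π / 2, log (1 + 2 * r * cos θ + r ^ 2) / 2 := by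
    intro r hr
    refine intervalIntegral.integral_congr fun θ hθ => ?_
    rw [Set.uIcc_of_le (by positivity)] at hθ
    have : 0 ≤ cos θ := cos_nonneg_of_mem_Icc ⟨by linarith [hθ.1, pi_pos], hθ.2⟩
    rw [abs_of_nonneg (by positivity)]
  have hsum : Summable fun j : ℕ => 1 / (2 * (j : ℝ) + 1) ^ 2 := by
    have h := (Real.summable_one_div_nat_pow (p := 2)).mpr one_lt_two
    have hinj : Function.Injective (fun j : ℕ => 2 * j + 1) := fun a b hab => by
      simpa using hab
    simpa [Function.comp_def] using h.comp_injective hinj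
  have hd : ContinuousOn (fun r : ℝ => ∑' j : ℕ,
      (-1 : ℝ) ^ j / (2 * (j : ℝ) + 1) ^ 2 * r ^ (2 * j + 1)) (Set.Icc 0 1) := by
    refine continuousOn_tsum (fun j => by fun_prop) hsum fun j r hr => ?_
    rw [norm_mul, norm_div, norm_pow, norm_neg, norm_one, one_pow, norm_pow, norm_pow]
    rw [norm_of_nonneg (by positivity : (0 : ℝ) ≤ 2 * j + 1), norm_of_nonneg hr.1]
    exact mul_le_of_le_one_right (by positivity) (pow_le_one₀ hr.1 hr.2)
  have hne : (𝓝[<] (1 : ℝ)).NeBot := inferInstance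
  have t1 : Tendsto (fun r : ℝ =>
      ∫ θ in (0 : ℝ)..π / 2, log (1 + |2 * r * cos θ| + r ^ 2) / 2) (𝓝[<] 1)
      (𝓝 (∫ θ in (0 : ℝ)..π / 2, log (1 + |2 * 1 * cos θ| + 1 ^ 2) / 2)) :=
    (hc.tendsto 1).mono_left nhdsWithin_le_nhds
  have t2 := (hd 1 (by simp)).mono_left
    (nhdsWithin_mono (s := Set.Ico 0 1) 1 Set.Ico_subset_Icc_self)
  rw [nhdsWithin_Ico_eq_nhdsLT zero_lt_one] at t2
  have hev : (fun r : ℝ => ∫ θ in (0 : ℝ)..π / 2, log (1 + |2 * r * cos θ| + r ^ 2) / 2)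
      =ᶠ[𝓝[<] 1] fun r : ℝ => ∑' j : ℕ,
      (-1 : ℝ) ^ j / (2 * (j : ℝ) + 1) ^ 2 * r ^ (2 * j + 1) := by
    filter_upwards [Ico_mem_nhdsLT zero_lt_one] with r hr
    rw [heq r hr.1, (hasSum_integral_log_one_add_two_mul_cos
      (by rw [abs_of_nonneg hr.1]; exact hr.2)).tsum_eq]
  have h := tendsto_nhds_unique (t1.congr' hev) t2
  rw [heq 1 zero_le_one] at h
  simp only [one_pow, mul_one] at h
  rw [catalanConstant, ← h]
  congr 1
  ext θ
  ring_nf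

theorem log_sqrt_two_mul_sin_eq (x : ℝ) :
    log (√2 * sin x) = log (1 - cos (2 * x)) / 2 := by
  have : 1 - cos (2 * x) = (√2 * sin x) ^ 2 := by
    rw [mul_pow, sq_sqrt zero_le_two, cos_two_mul, cos_sq']
    ring
  rw [this, log_pow]
  push_cast
  ring

theorem log_sqrt_two_mul_sin_eq' (θ : ℝ) :
    log (√2 * sin ((θ + π) / 2)) = log (2 + 2 * cos θ) / 2 - log 2 / 2 ∨ 1 + cos θ = 0 := by
  by_cases h : 1 + cos θ = 0
  · exact Or.inr h
  · left
    rw [log_sqrt_two_mul_sin_eq, mul_div_cancel₀ _ two_ne_zero, cos_add_pi,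
      show 2 + 2 * cos θ = 2 * (1 + cos θ) by ring, log_mul two_ne_zero h, sub_neg_eq_add]
    ring

/-- Substituting `x = θ/(2π) + 1/2` turns the integrand into `½ log (2 + 2 cos θ) - ½ log 2` on
`[-π/2, π/2]`, and evenness doubles the previous integral. -/
theorem integral_log_sqrt_two_mul_sin :
    ∫ x in (1 / 4 : ℝ)..3 / 4, log (√2 * sin (π * x)) = catalanConstant / π - log 2 / 4 := by
  have hcont : ∀ a b : ℝ, -(π / 2) ≤ a → a ≤ b → b ≤ π / 2 →
      IntervalIntegrable (fun θ => log (2 + 2 * cos θ) / 2) volume a b := by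
    intro a b ha hab hb
    refine ContinuousOn.intervalIntegrable fun θ hθ => ContinuousAt.continuousWithinAt ?_
    rw [Set.uIcc_of_le hab] at hθ
    have : 0 ≤ cos θ := cos_nonneg_of_mem_Icc ⟨ha.trans hθ.1, hθ.2.trans hb⟩
    have h2 : 2 + 2 * cos θ ≠ 0 := by positivity
    fun_prop (disch := assumption)
  have hneg : ∫ θ in -(π / 2)..0, log (2 + 2 * cos θ) / 2 = catalanConstant := by
    rw [← integral_log_two_add_two_mul_cos]
    have := intervalIntegral.integral_comp_neg (a := 0) (b := π / 2)
      (fun θ => log (2 + 2 * cos θ) / 2)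
    simpa using this.symm
  have htot : ∫ θ in -(π / 2)..π / 2, (log (2 + 2 * cos θ) / 2 - log 2 / 2) =
      2 * catalanConstant - π * (log 2 / 2) := by
    rw [intervalIntegral.integral_sub (hcont _ _ le_rfl (by linarith [pi_pos]) le_rfl) (by simp),
      ← intervalIntegral.integral_add_adjacent_intervals
        (hcont (-(π / 2)) 0 le_rfl (by linarith [pi_pos]) (by linarith [pi_pos]))
        (hcont 0 (π / 2) (by linarith [pi_pos]) (by linarith [pi_pos]) le_rfl), hneg,
      integral_log_two_add_two_mul_cos]
    simp
    ring
  have hsub : ∫ θ in -(π / 2)..π / 2, (log (2 + 2 * cos θ) / 2 - log 2 / 2) =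
      ∫ θ in -(π / 2)..π / 2, log (√2 * sin (π * (θ / (2 * π) + 1 / 2))) := by
    refine intervalIntegral.integral_congr fun θ hθ => ?_
    rw [Set.uIcc_of_le (by linarith [pi_pos])] at hθ
    have : 0 ≤ cos θ := cos_nonneg_of_mem_Icc hθ
    rw [show π * (θ / (2 * π) + 1 / 2) = (θ + π) / 2 by field_simp]
    exact ((log_sqrt_two_mul_sin_eq' θ).resolve_right (by positivity)).symm
  rw [hsub, intervalIntegral.integral_comp_div_add
    (f := fun x => log (√2 * sin (π * x))) (by positivity)] at htot
  rw [show -(π / 2) / (2 * π) + 1 / 2 = (1 / 4 : ℝ) by field_simp; norm_num,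
    show π / 2 / (2 * π) + 1 / 2 = (3 / 4 : ℝ) by field_simp; norm_num, smul_eq_mul] at htot
  have hpi := pi_ne_zero
  rw [← mul_right_inj' (mul_ne_zero two_ne_zero hpi), htot]
  field_simp
  ring

end Catalan

/-! ### Riemann sums of unimodal functions. -/

section Unimodal

open MeasureTheory

theorem MonotoneOn.abs_sum_range_sub_integral_le {f : ℝ → ℝ} {N : ℕ} {m B : ℝ} (hm : 0 ≤ m)
    (hmN : m ≤ N) (hmono : MonotoneOn f (Set.Icc 0 m)) (hanti : AntitoneOn f (Set.Icc m N))
    (h0 : ∀ x, 0 ≤ f x) (hB : ∀ x, f x ≤ B) (hint : Continuous f) :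
    |∑ l ∈ Finset.range N, f l - ∫ x in (0 : ℝ)..N, f x| ≤ 2 * B := by
  -- The peak lies in `[h, h + 1)`. The monotone comparisons apply on `[0, h]` and `[h + 1, N]`; the
  -- one interval left over contributes between `0` and `B`.
  set h := ⌊m⌋₊ with hh
  have hhm : (h : ℝ) ≤ m := Nat.floor_le hm
  have hmh : m < h + 1 := Nat.lt_floor_add_one m
  have hii : ∀ a b : ℝ, IntervalIntegrable f volume a b := fun a b => hint.intervalIntegrable a b
  have hhN : h ≤ N := by exact_mod_cast hhm.trans hmN
  have hm1 : MonotoneOn f (Set.Icc ((0 : ℕ) : ℝ) (h : ℝ)) :=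
    hmono.mono (by simpa using Set.Icc_subset_Icc_right hhm)
  have u1 := hm1.sum_le_integral_Ico (Nat.zero_le h)
  have l1 := hm1.integral_le_sum_Ico (Nat.zero_le h)
  rw [← Finset.range_eq_Ico] at u1 l1
  have e1 := Finset.sum_range_succ (fun i : ℕ => f i) h
  rw [Finset.sum_range_succ'] at e1
  rw [Nat.cast_zero] at u1 l1
  have b0 := h0 0
  have bh := h0 h
  have bh' := hB h
  have bz : f ((0 : ℕ) : ℝ) = f 0 := by simp
  have key : ∑ l ∈ Finset.range h, f l ≤ ∫ x in (0 : ℝ)..h, f x := u1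
  have key' : ∫ x in (0 : ℝ)..h, f x ≤ ∑ l ∈ Finset.range h, f l + f h := by linarith
  rcases hhN.eq_or_lt with heq | hlt
  · rw [heq] at key key' bh bh'
    rw [abs_le]
    constructor <;> linarith
  · have ha1 : AntitoneOn f (Set.Icc ((h + 1 : ℕ) : ℝ) (N : ℝ)) :=
      hanti.mono (Set.Icc_subset_Icc_left (by push_cast; linarith))
    have u2 := ha1.sum_le_integral_Ico hlt
    have l2 := ha1.integral_le_sum_Ico hlt
    have e2 : ∑ i ∈ Finset.Ico (h + 1) N, f ((i + 1 : ℕ) : ℝ) =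
        ∑ i ∈ Finset.Ico (h + 1) N, f (i : ℝ) - f ((h + 1 : ℕ) : ℝ) + f N := by
      have := Finset.sum_Ico_sub (fun i : ℕ => f i) hlt
      rw [Finset.sum_sub_distrib] at this
      linarith
    have e3 : ∑ l ∈ Finset.range N, f l =
        ∑ l ∈ Finset.range h, f l + f h + ∑ l ∈ Finset.Ico (h + 1) N, f l := by
      rw [← Finset.sum_range_succ (fun i : ℕ => f i), Finset.sum_range_add_sum_Ico _ hlt]
    have e4 : ∫ x in (0 : ℝ)..N, f x = (∫ x in (0 : ℝ)..h, f x) +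
        (∫ x in (h : ℝ)..(h + 1 : ℕ), f x) + ∫ x in ((h + 1 : ℕ) : ℝ)..N, f x := by
      rw [intervalIntegral.integral_add_adjacent_intervals (hii _ _) (hii _ _),
        intervalIntegral.integral_add_adjacent_intervals (hii _ _) (hii _ _)]
    have u3 : ∫ x in (h : ℝ)..(h + 1 : ℕ), f x ≤ B := by
      have := intervalIntegral.integral_mono (a := (h : ℝ)) (b := (h + 1 : ℕ)) (by simp)
        (hii _ _) (intervalIntegrable_const (c := B)) hB
      simpa using this
    have l3 : 0 ≤ ∫ x in (h : ℝ)..(h + 1 : ℕ), f x :=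
      intervalIntegral.integral_nonneg (by simp) fun x _ => h0 x
    have b1 := hB (h + 1 : ℕ)
    have b2 := h0 N
    rw [abs_le]
    constructor <;> linarith

theorem sum_range_exp_neg_sq_le {N : ℕ} (hN : 0 < N) :
    ∑ l ∈ Finset.range N, Real.exp (-(((l : ℝ) - N / 4) ^ 2 / (18 * N))) ≤ 10 * √N := by
  have hN' : (1 : ℝ) ≤ N := by exact_mod_cast hN
  set b : ℝ := 1 / (18 * N) with hb
  have hbpos : 0 < b := by positivity
  set f : ℝ → ℝ := fun x => Real.exp (-b * (x - N / 4) ^ 2) with hf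
  have h := MonotoneOn.abs_sum_range_sub_integral_le (f := f) (N := N) (m := N / 4) (B := 1)
    (by positivity) (by linarith)
    (by
      intro x hx y hy hxy
      simp only [hf, Real.exp_le_exp]
      nlinarith [hx.2, hy.2, mul_nonneg hbpos.le
        (mul_nonneg (sub_nonneg.2 hxy) (by linarith [hx.2, hy.2] : (0 : ℝ) ≤ N / 2 - x - y))])
    (by
      intro x hx y hy hxy
      simp only [hf, Real.exp_le_exp]
      nlinarith [hx.1, hy.1, mul_nonneg hbpos.le
        (mul_nonneg (sub_nonneg.2 hxy) (by linarith [hx.1, hy.1] : (0 : ℝ) ≤ x + y - N / 2))])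
    (fun x => (Real.exp_pos _).le)
    (fun x => by
      simp only [hf, Real.exp_le_one_iff]
      nlinarith [sq_nonneg (x - N / 4)])
    (by fun_prop)
  have hint : ∫ x in (0 : ℝ)..N, f x ≤ √(Real.pi / b) := by
    rw [← integral_gaussian b, ← integral_sub_right_eq_self _ ((N : ℝ) / 4),
      intervalIntegral.integral_of_le (by positivity)]
    refine setIntegral_le_integral ?_ (Filter.Eventually.of_forall fun x => (Real.exp_pos _).le)
    exact (integrable_exp_neg_mul_sq hbpos).comp_sub_right _
  -- The Gaussian integral is `√(18πN)`, and `18π < 64`; the unimodal error `2 ≤ 2√N` makes up the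
  -- rest of `10√N`.
  have hs : √(Real.pi / b) ≤ 8 * √N := by
    rw [show (8 : ℝ) * √N = √(64 * N) by
      rw [Real.sqrt_mul (by norm_num), show (64 : ℝ) = 8 ^ 2 by norm_num,
        Real.sqrt_sq (by norm_num)]]
    apply Real.sqrt_le_sqrt
    rw [hb, div_div_eq_mul_div, div_one]
    nlinarith [Real.pi_lt_d2]
  have h1 : (1 : ℝ) ≤ √N := Real.one_le_sqrt.mpr hN'
  have hsum : ∑ l ∈ Finset.range N, Real.exp (-(((l : ℝ) - N / 4) ^ 2 / (18 * N))) =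
      ∑ l ∈ Finset.range N, f l := by
    refine Finset.sum_congr rfl fun l _ => ?_
    simp only [hf, hb]
    congr 1
    ring
  rw [hsum]
  have := (abs_le.mp h).2
  linarith

end Unimodal

/-! ### The logarithmic potential and the sum of its positive part. -/

section LogSin

open Real MeasureTheory

/-- The logarithmic potential `log (√2 sin (π x))`, normalized to vanish at `1/4` and `3/4`. -/
noncomputable def logSinPi (x : ℝ) : ℝ := log (√2 * sin (π * x))

theorem logSinPi_one_sub (x : ℝ) : logSinPi (1 - x) = logSinPi x := by
  rw [logSinPi, logSinPi, mul_sub, mul_one, sin_pi_sub]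

theorem logSinPi_quarter_add (y : ℝ) : logSinPi (1 / 4 + y) = log (1 + sin (2 * π * y)) / 2 := by
  rw [logSinPi, log_sqrt_two_mul_sin_eq,
    show 2 * (π * (1 / 4 + y)) = 2 * π * y + π / 2 by ring, cos_add_pi_div_two, sub_neg_eq_add]

theorem logSinPi_zero : logSinPi 0 = 0 := by simp [logSinPi]

/-- Jordan's inequality `4y ≤ sin 2πy` combined with `log (1 + s) ≥ s / (1 + s) ≥ s / 2`. This
linear growth away from the zero at `1/4` is what makes deficiencies quadratic. -/
theorem sub_le_logSinPi {x : ℝ} (h1 : 1 / 4 ≤ x) (h2 : x ≤ 1 / 2) : x - 1 / 4 ≤ logSinPi x := by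
  obtain ⟨y, rfl⟩ : ∃ y, x = 1 / 4 + y := ⟨x - 1 / 4, by ring⟩
  rw [logSinPi_quarter_add]
  have hs : 4 * y ≤ sin (2 * π * y) := by
    have := mul_le_sin (x := 2 * π * y) (by have := pi_pos; nlinarith) (by have := pi_pos; nlinarith)
    calc 4 * y = 2 / π * (2 * π * y) := by field_simp; ring
      _ ≤ _ := this
  have hs1 := sin_le_one (2 * π * y)
  have hpos : 0 < 1 + sin (2 * π * y) := by linarith
  have := one_sub_inv_le_log_of_pos hpos
  have h3 : sin (2 * π * y) / 2 ≤ 1 - (1 + sin (2 * π * y))⁻¹ := by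
    rw [show 1 - (1 + sin (2 * π * y))⁻¹ = sin (2 * π * y) / (1 + sin (2 * π * y)) by
      field_simp; ring]
    apply div_le_div_of_nonneg_left <;> linarith
  linarith

theorem logSinPi_le_sub {x : ℝ} (h0 : 0 < x) (h1 : x ≤ 1 / 4) : logSinPi x ≤ x - 1 / 4 := by
  obtain ⟨y, rfl⟩ : ∃ y, x = 1 / 4 - y := ⟨1 / 4 - x, by ring⟩
  rw [sub_eq_add_neg (1 / 4) y, logSinPi_quarter_add, mul_neg, sin_neg]
  have hs : 4 * y ≤ sin (2 * π * y) := by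
    have := mul_le_sin (x := 2 * π * y) (by have := pi_pos; nlinarith) (by have := pi_pos; nlinarith)
    calc 4 * y = 2 / π * (2 * π * y) := by field_simp; ring
      _ ≤ _ := this
  have hs1 : sin (2 * π * y) < 1 := by
    rw [← sin_pi_div_two]
    apply sin_lt_sin_of_lt_of_le_pi_div_two <;> have := pi_pos <;> nlinarith
  have := log_le_sub_one_of_pos (x := 1 + -sin (2 * π * y)) (by linarith)
  linarith

theorem abs_logSinPi_le {x : ℝ} (h : |x - 1 / 4| ≤ 1 / 16) : |logSinPi x| ≤ 8 * |x - 1 / 4| := by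
  obtain ⟨y, rfl⟩ : ∃ y, x = 1 / 4 + y := ⟨x - 1 / 4, by ring⟩
  rw [logSinPi_quarter_add, add_sub_cancel_left] at *
  set s := sin (2 * π * y) with hs
  have h1 : |s| ≤ 7 * |y| := by
    refine (abs_sin_le_abs (x := 2 * π * y)).trans ?_
    rw [abs_mul, abs_of_pos two_pi_pos]
    nlinarith [pi_lt_d2, abs_nonneg y]
  have h2 : |s| ≤ 1 / 2 := by linarith
  have hpos : 0 < 1 + s := by linarith [(abs_le.mp h2).1]
  have l1 := one_sub_inv_le_log_of_pos hpos
  have l2 := log_le_sub_one_of_pos hpos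
  have h3 : -(2 * |s|) ≤ 1 - (1 + s)⁻¹ := by
    rw [show 1 - (1 + s)⁻¹ = s / (1 + s) by field_simp; ring, le_div_iff₀ hpos]
    rcases abs_cases s with ⟨h, _⟩ | ⟨h, _⟩ <;> rw [h] at h2 ⊢ <;> nlinarith
  have h4 := le_abs_self s
  rw [abs_le]
  constructor <;> linarith [abs_nonneg y]

theorem logSinPi_nonneg {x : ℝ} (h1 : 1 / 4 ≤ x) (h2 : x ≤ 3 / 4) : 0 ≤ logSinPi x := by
  rcases le_total x (1 / 2) with h | h
  · linarith [sub_le_logSinPi h1 h]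
  · rw [← logSinPi_one_sub]
    linarith [sub_le_logSinPi (x := 1 - x) (by linarith) (by linarith)]

theorem logSinPi_nonpos {x : ℝ} (h0 : 0 ≤ x) (h : x ≤ 1 / 4) : logSinPi x ≤ 0 := by
  rcases h0.eq_or_lt with rfl | h0
  · rw [logSinPi_zero]
  · linarith [logSinPi_le_sub h0 h]

theorem logSinPi_nonpos' {x : ℝ} (h : 3 / 4 ≤ x) (h1 : x ≤ 1) : logSinPi x ≤ 0 := by
  rw [← logSinPi_one_sub]
  exact logSinPi_nonpos (by linarith) (by linarith)

theorem logSinPi_le (x : ℝ) : logSinPi x ≤ log 2 / 2 := by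
  rw [← log_sqrt zero_le_two, logSinPi, ← log_abs]
  by_cases h : √2 * sin (π * x) = 0
  · rw [h, abs_zero, log_zero]
    exact log_nonneg (Real.one_le_sqrt.mpr one_le_two)
  · apply log_le_log (abs_pos.mpr h)
    rw [abs_mul, abs_of_pos (by positivity)]
    exact mul_le_of_le_one_right (by positivity) (abs_sin_le_one _)

theorem monotoneOn_max_logSinPi :
    MonotoneOn (fun x => max 0 (logSinPi x)) (Set.Icc 0 (1 / 2)) := by
  intro x hx y hy hxy
  simp only
  rcases le_total x (1 / 4) with h | h
  · rw [max_eq_left (logSinPi_nonpos hx.1 h)]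
    exact le_max_left _ _
  · apply max_le_max_left
    have hp := pi_pos
    apply log_le_log
    · have : 0 < sin (π * x) := sin_pos_of_pos_of_lt_pi (by nlinarith) (by nlinarith [hx.2])
      positivity
    · apply mul_le_mul_of_nonneg_left _ (by positivity)
      apply sin_le_sin_of_le_of_le_pi_div_two <;> nlinarith [hx.2, hy.2, hx.1]

theorem antitoneOn_max_logSinPi :
    AntitoneOn (fun x => max 0 (logSinPi x)) (Set.Icc (1 / 2) 1) := by
  intro x hx y hy hxy
  have := monotoneOn_max_logSinPi (a := 1 - y) (b := 1 - x)
    ⟨by linarith [hy.2], by linarith [hy.1]⟩ ⟨by linarith [hx.2], by linarith [hx.1]⟩ (by linarith)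
  simpa only [logSinPi_one_sub] using this

theorem continuous_max_logSinPi : Continuous fun x => max 0 (logSinPi x) := by
  -- Truncating inside the logarithm removes its singularities; `log` of a real depends only on the
  -- absolute value.
  have : (fun x => max 0 (logSinPi x)) = fun x => log (max 1 (√2 * |sin (π * x)|)) := by
    ext x
    rw [logSinPi, ← log_abs, abs_mul, abs_of_pos (by positivity : (0 : ℝ) < √2)]
    set v := √2 * |sin (π * x)|
    have hv : 0 ≤ v := by positivity
    rcases le_total v 1 with h | h
    · rw [max_eq_left h, log_one, max_eq_left (log_nonpos hv h)]
    · rw [max_eq_right h, max_eq_right (log_nonneg h)]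
  rw [this]
  refine Continuous.log (by fun_prop) fun x => ?_
  have := le_max_left 1 (√2 * |sin (π * x)|)
  linarith

theorem integral_max_logSinPi :
    ∫ x in (0 : ℝ)..1, max 0 (logSinPi x) = catalanConstant / π - log 2 / 4 := by
  have hii : ∀ a b, IntervalIntegrable (fun x => max 0 (logSinPi x)) volume a b :=
    fun a b => continuous_max_logSinPi.intervalIntegrable a b
  rw [← intervalIntegral.integral_add_adjacent_intervals (hii 0 (1 / 4)) (hii (1 / 4) 1),
    ← intervalIntegral.integral_add_adjacent_intervals (hii (1 / 4) (3 / 4)) (hii (3 / 4) 1),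
    ← integral_log_sqrt_two_mul_sin]
  have h1 : ∫ x in (0 : ℝ)..1 / 4, max 0 (logSinPi x) = ∫ x in (0 : ℝ)..1 / 4, (0 : ℝ) := by
    refine intervalIntegral.integral_congr fun x hx => ?_
    rw [Set.uIcc_of_le (by norm_num)] at hx
    exact max_eq_left (logSinPi_nonpos hx.1 hx.2)
  have h2 : ∫ x in (3 / 4 : ℝ)..1, max 0 (logSinPi x) = ∫ x in (3 / 4 : ℝ)..1, (0 : ℝ) := by
    refine intervalIntegral.integral_congr fun x hx => ?_
    rw [Set.uIcc_of_le (by norm_num)] at hx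
    exact max_eq_left (logSinPi_nonpos' hx.1 hx.2)
  have h3 : ∫ x in (1 / 4 : ℝ)..3 / 4, max 0 (logSinPi x) =
      ∫ x in (1 / 4 : ℝ)..3 / 4, log (√2 * sin (π * x)) := by
    refine intervalIntegral.integral_congr fun x hx => ?_
    rw [Set.uIcc_of_le (by norm_num)] at hx
    exact max_eq_right (logSinPi_nonneg hx.1 hx.2)
  rw [h1, h2, h3]
  simp

/-- The difference is the integral of a nonnegative function. It later ensures that `exp (2GN/π)`
dominates powers of `N` without numerics for `G`. -/
theorem log_two_div_four_le_catalanConstant_div_pi : log 2 / 4 ≤ catalanConstant / π := by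
  have : 0 ≤ ∫ x in (0 : ℝ)..1, max 0 (logSinPi x) :=
    intervalIntegral.integral_nonneg zero_le_one fun x _ => le_max_left _ _
  rw [integral_max_logSinPi] at this
  linarith

theorem abs_sum_range_max_logSinPi_sub_le (N : ℕ) :
    |∑ l ∈ Finset.range N, max 0 (logSinPi (l / N)) - N * (catalanConstant / π - log 2 / 4)| ≤
      log 2 := by
  rcases Nat.eq_zero_or_pos N with rfl | hN
  · simpa using log_nonneg one_le_two
  have hN' : (0 : ℝ) < N := by exact_mod_cast hN
  have h := MonotoneOn.abs_sum_range_sub_integral_le (f := fun x => max 0 (logSinPi (x / N)))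
    (N := N) (m := N / 2) (B := log 2 / 2) (by positivity) (by linarith)
    (by
      intro x hx y hy hxy
      refine monotoneOn_max_logSinPi ?_ ?_ (by gcongr)
      · exact ⟨div_nonneg hx.1 hN'.le, by rw [div_le_iff₀ hN']; linarith [hx.2]⟩
      · exact ⟨div_nonneg hy.1 hN'.le, by rw [div_le_iff₀ hN']; linarith [hy.2]⟩)
    (by
      intro x hx y hy hxy
      refine antitoneOn_max_logSinPi ?_ ?_ (by gcongr)
      · exact ⟨by rw [le_div_iff₀ hN']; linarith [hx.1], by rw [div_le_iff₀ hN']; linarith [hx.2]⟩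
      · exact ⟨by rw [le_div_iff₀ hN']; linarith [hy.1], by rw [div_le_iff₀ hN']; linarith [hy.2]⟩)
    (fun x => le_max_left _ _)
    (fun x => max_le (by have := log_nonneg one_le_two (x := 2); linarith) (logSinPi_le _))
    (continuous_max_logSinPi.comp (continuous_id.div_const _))
  rw [intervalIntegral.integral_comp_div (fun x => max 0 (logSinPi x)) hN'.ne', zero_div,
    div_self hN'.ne', integral_max_logSinPi, smul_eq_mul] at h
  linarith

end LogSin

/-! ### Arcs of residues and counting of offsets. -/

section Arcs

variable {N : ℕ}

theorem Fin.val_sub_cases (a b : Fin N) :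
    ((b : ℕ) ≤ a ∧ ((a - b : Fin N) : ℕ) = a - b) ∨
      ((a : ℕ) < b ∧ ((a - b : Fin N) : ℕ) = N + a - b) := by
  have ha := a.2
  have hb := b.2
  rw [Fin.val_sub]
  rcases le_or_gt (b : ℕ) a with h | h
  · left
    refine ⟨h, ?_⟩
    rw [show N - (b : ℕ) + a = (a - b) + N by omega, Nat.add_mod_right, Nat.mod_eq_of_lt (by omega)]
  · right
    refine ⟨h, ?_⟩
    rw [Nat.mod_eq_of_lt (by omega)]
    omega

/-- The arc of the `n` residues `a, a + 1, …, a + n - 1` modulo `N`. -/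
def finArc (a : Fin N) (n : ℕ) : Finset (Fin N) :=
  Finset.univ.filter fun s => ((s - a : Fin N) : ℕ) < n

theorem mem_finArc {a s : Fin N} {n : ℕ} : s ∈ finArc a n ↔ ((s - a : Fin N) : ℕ) < n := by
  simp [finArc]

theorem Fin.sum_comp_val_sub {M : Type*} [AddCommMonoid M] [NeZero N] (f : ℕ → M) (w : Fin N) :
    ∑ s : Fin N, f ((s - w : Fin N) : ℕ) = ∑ l ∈ Finset.range N, f l := by
  rw [← Fin.sum_univ_eq_sum_range]
  exact Equiv.sum_comp (Equiv.subRight w) fun s => f s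

theorem Fin.sum_comp_sub_val {M : Type*} [AddCommMonoid M] [NeZero N] (f : ℕ → M) (w : Fin N) :
    ∑ s : Fin N, f ((w - s : Fin N) : ℕ) = ∑ l ∈ Finset.range N, f l := by
  rw [← Fin.sum_univ_eq_sum_range]
  exact Equiv.sum_comp (Equiv.subLeft w) fun s => f s

theorem Fin.card_filter_val_sub [NeZero N] (p : ℕ → Prop) [DecidablePred p] (w : Fin N) :
    (Finset.univ.filter fun s : Fin N => p ((s - w : Fin N) : ℕ)).card =
      ((Finset.range N).filter p).card := by
  rw [Finset.card_filter, Finset.card_filter]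
  exact Fin.sum_comp_val_sub (fun l => if p l then 1 else 0) w

theorem Fin.card_filter_sub_val [NeZero N] (p : ℕ → Prop) [DecidablePred p] (w : Fin N) :
    (Finset.univ.filter fun s : Fin N => p ((w - s : Fin N) : ℕ)).card =
      ((Finset.range N).filter p).card := by
  rw [Finset.card_filter, Finset.card_filter]
  exact Fin.sum_comp_sub_val (fun l => if p l then 1 else 0) w

theorem card_finArc [NeZero N] (a : Fin N) {n : ℕ} (hn : n ≤ N) : (finArc a n).card = n := by
  rw [finArc, Fin.card_filter_val_sub (fun l => l < n)]
  have : (Finset.range N).filter (fun l => l < n) = Finset.range n := by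
    ext l
    simp only [Finset.mem_filter, Finset.mem_range]
    omega
  rw [this, Finset.card_range]

theorem finArc_mono (a : Fin N) {m n : ℕ} (h : m ≤ n) : finArc a m ⊆ finArc a n := fun s hs => by
  rw [mem_finArc] at *
  omega

theorem IsCyclicallyContiguous.exists_eq_finArc [NeZero N] {S : Finset (Fin N)}
    (hS : IsCyclicallyContiguous S) : ∃ a, S = finArc a S.card := by
  obtain ⟨a, m, h⟩ := hS
  let r : Fin N := ⟨a % N, Nat.mod_lt _ (NeZero.pos N)⟩
  have har : (r : ℕ) ≡ a [MOD N] := Nat.mod_modEq a N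
  -- The run of integers may be longer than `N` and wrap around; truncating at `N` leaves the same
  -- residues.
  have key : S = finArc r (min m N) := by
    ext x
    rw [h, mem_finArc]
    have hd : (x : ℕ) ≡ r + ((x - r : Fin N) : ℕ) [MOD N] := by
      rcases Fin.val_sub_cases x r with ⟨h1, h2⟩ | ⟨h1, h2⟩
      · rw [h2, show (r : ℕ) + (x - r) = x by omega]
      · rw [h2, show (r : ℕ) + (N + x - r) = x + N by have := r.2; omega]
        simp [Nat.ModEq]
    have hlt := (x - r).2
    constructor
    · rintro ⟨i, hi, hx⟩
      have h3 : ((x - r : Fin N) : ℕ) ≡ i [MOD N] := by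
        refine Nat.ModEq.add_left_cancel' (r : ℕ) ?_
        exact hd.symm.trans (hx.trans (har.symm.add_right i))
      have h4 : ((x - r : Fin N) : ℕ) = i % N := by
        rw [← Nat.mod_eq_of_lt hlt]
        exact h3
      have := Nat.mod_le i N
      omega
    · intro hx
      exact ⟨((x - r : Fin N) : ℕ), by omega, hd.trans (har.add_right _)⟩
  refine ⟨r, ?_⟩
  have hc := card_finArc r (min_le_right m N)
  rw [key, hc]

theorem compl_finArc [NeZero N] (a : Fin N) {n : ℕ} (hn : n ≤ N) :
    ∃ b : Fin N, (finArc a n)ᶜ = finArc b (N - n) := by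
  have ha := a.2
  refine ⟨⟨(a + n) % N, Nat.mod_lt _ (NeZero.pos N)⟩, ?_⟩
  set b : Fin N := ⟨(a + n) % N, Nat.mod_lt _ (NeZero.pos N)⟩ with hb
  have hbv : (b : ℕ) = a + n ∨ (b : ℕ) + N = a + n := by
    have : (b : ℕ) = (a + n) % N := rfl
    rcases lt_or_ge ((a : ℕ) + n) N with h | h
    · left; rw [this, Nat.mod_eq_of_lt h]
    · right
      rw [this, Nat.mod_eq_sub_mod h, Nat.mod_eq_of_lt (by omega)]
      omega
  have hb2 := b.2
  ext s
  have hs := s.2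
  rw [Finset.mem_compl, mem_finArc, mem_finArc]
  rcases Fin.val_sub_cases s a with ⟨h1, h2⟩ | ⟨h1, h2⟩ <;>
  rcases Fin.val_sub_cases s b with ⟨h3, h4⟩ | ⟨h3, h4⟩ <;> omega

/-- Seen from a point `w` outside of an arc, the arc is an interval of offsets. -/
theorem mem_finArc_iff_of_notMem {a w : Fin N} {n : ℕ} (hw : w ∉ finArc a n) (s : Fin N) :
    s ∈ finArc a n ↔ ((a - w : Fin N) : ℕ) ≤ ((s - w : Fin N) : ℕ) ∧
      ((s - w : Fin N) : ℕ) < ((a - w : Fin N) : ℕ) + n := by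
  rw [mem_finArc] at *
  have hs := s.2
  have ha := a.2
  have hw' := w.2
  rcases Fin.val_sub_cases s a with ⟨h1, h2⟩ | ⟨h1, h2⟩ <;>
  rcases Fin.val_sub_cases s w with ⟨h3, h4⟩ | ⟨h3, h4⟩ <;>
  rcases Fin.val_sub_cases a w with ⟨h5, h6⟩ | ⟨h5, h6⟩ <;>
  rcases Fin.val_sub_cases w a with ⟨h7, h8⟩ | ⟨h7, h8⟩ <;> omega

theorem val_sub_add_le_of_notMem_finArc {a w : Fin N} {n : ℕ} (hn : 0 < n)
    (hw : w ∉ finArc a n) : 0 < ((a - w : Fin N) : ℕ) ∧ ((a - w : Fin N) : ℕ) + n ≤ N := by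
  rw [mem_finArc] at *
  have ha := a.2
  have hw' := w.2
  rcases Fin.val_sub_cases a w with ⟨h5, h6⟩ | ⟨h5, h6⟩ <;>
  rcases Fin.val_sub_cases w a with ⟨h7, h8⟩ | ⟨h7, h8⟩ <;> omega

theorem le_card_filter_range {p q : ℝ} (hq : q ≤ N) (hp : 0 ≤ p) :
    q - p - 1 ≤ (((Finset.range N).filter fun l : ℕ => p ≤ l ∧ (l : ℝ) < q).card : ℝ) := by
  have hsub : Finset.Ico ⌈p⌉₊ ⌈q⌉₊ ⊆ (Finset.range N).filter fun l : ℕ => p ≤ l ∧ (l : ℝ) < q := by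
    intro l hl
    rw [Finset.mem_Ico, Nat.ceil_le, Nat.lt_ceil] at hl
    rw [Finset.mem_filter, Finset.mem_range]
    exact ⟨by exact_mod_cast hl.2.trans_le hq, hl⟩
  have h1 := Finset.card_le_card hsub
  rw [Nat.card_Ico] at h1
  have h2 : (⌈q⌉₊ : ℝ) ≤ ((⌈q⌉₊ - ⌈p⌉₊ : ℕ) : ℝ) + ⌈p⌉₊ := by
    exact_mod_cast (by omega : ⌈q⌉₊ ≤ (⌈q⌉₊ - ⌈p⌉₊) + ⌈p⌉₊)
  have h3 := Nat.le_ceil q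
  have h4 := Nat.ceil_lt_add_one hp
  have h5 : ((⌈q⌉₊ - ⌈p⌉₊ : ℕ) : ℝ) ≤
      (((Finset.range N).filter fun l : ℕ => p ≤ l ∧ (l : ℝ) < q).card : ℝ) := by
    exact_mod_cast h1
  linarith

theorem card_filter_abs_sub_le (y : ℝ) {R : ℝ} (hR : 0 ≤ R) :
    (((Finset.range N).filter fun l : ℕ => |(l : ℝ) - y| ≤ R).card : ℝ) ≤ 2 * R + 1 := by
  have hsub : ((Finset.range N).filter fun l : ℕ => |(l : ℝ) - y| ≤ R).image (fun l : ℕ => (l : ℤ)) ⊆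
      Finset.Icc ⌈y - R⌉ ⌊y + R⌋ := by
    intro k hk
    obtain ⟨l, hl, rfl⟩ := Finset.mem_image.mp hk
    have h := abs_le.mp (Finset.mem_filter.mp hl).2
    rw [Finset.mem_Icc, Int.ceil_le, Int.le_floor]
    push_cast
    constructor <;> linarith
  have h1 := Finset.card_le_card hsub
  rw [Finset.card_image_of_injective _ Nat.cast_injective, Int.card_Icc] at h1
  have h2 : (((⌊y + R⌋ + 1 - ⌈y - R⌉).toNat : ℤ) : ℝ) ≤ 2 * R + 1 := by
    rw [Int.toNat_eq_max]
    push_cast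
    refine max_le ?_ (by linarith)
    linarith [Int.floor_le (y + R), Int.le_ceil (y - R)]
  have h3 : (((Finset.range N).filter fun l : ℕ => |(l : ℝ) - y| ≤ R).card : ℝ) ≤
      (((⌊y + R⌋ + 1 - ⌈y - R⌉).toNat : ℤ) : ℝ) := by
    exact_mod_cast h1
  linarith

end Arcs

/-! ### Deficiency: the loss against the optimal set of offsets. -/

section Deficiency

variable {N : ℕ}

/-- The amount by which the sum of `logSinPi` over the offsets of `E` from `w` falls short of
the sum of its positive part over all offsets. -/
noncomputable def deficiency (E : Finset (Fin N)) (w : Fin N) : ℝ :=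
  ∑ s ∈ E, max 0 (-logSinPi (((s - w : Fin N) : ℕ) / N)) +
    ∑ s ∈ Eᶜ, max 0 (logSinPi (((s - w : Fin N) : ℕ) / N))

theorem deficiency_nonneg (E : Finset (Fin N)) (w : Fin N) : 0 ≤ deficiency E w :=
  add_nonneg (Finset.sum_nonneg fun _ _ => le_max_left _ _)
    (Finset.sum_nonneg fun _ _ => le_max_left _ _)

theorem sum_logSinPi_eq_sub_deficiency [NeZero N] (E : Finset (Fin N)) (w : Fin N) :
    ∑ s ∈ E, logSinPi (((s - w : Fin N) : ℕ) / N) =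
      ∑ l ∈ Finset.range N, max 0 (logSinPi (l / N)) - deficiency E w := by
  rw [← Fin.sum_comp_val_sub (fun l => max 0 (logSinPi (l / N))) w,
    ← Finset.sum_add_sum_compl E, deficiency]
  have : ∀ x : ℝ, x = max 0 x - max 0 (-x) := fun x => by
    rcases le_total 0 x with h | h
    · rw [max_eq_right h, max_eq_left (by linarith)]; ring
    · rw [max_eq_left h, max_eq_right (by linarith)]; ring
  rw [Finset.sum_congr rfl fun s _ => this (logSinPi (((s - w : Fin N) : ℕ) / N)),
    Finset.sum_sub_distrib]
  ring

theorem deficiency_eq_sum_univ (E : Finset (Fin N)) (w : Fin N) :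
    deficiency E w = ∑ s, if s ∈ E then max 0 (-logSinPi (((s - w : Fin N) : ℕ) / N)) else
      max 0 (logSinPi (((s - w : Fin N) : ℕ) / N)) := by
  rw [deficiency, ← Finset.sum_add_sum_compl E]
  congr 1
  · exact Finset.sum_congr rfl fun s hs => by rw [if_pos hs]
  · exact Finset.sum_congr rfl fun s hs => by rw [if_neg (Finset.mem_compl.mp hs)]

theorem card_mul_le_deficiency {E H : Finset (Fin N)} {w : Fin N} {h : ℝ}
    (hH : ∀ s ∈ H, (s ∈ E ∧ logSinPi (((s - w : Fin N) : ℕ) / N) ≤ -h) ∨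
      (s ∉ E ∧ h ≤ logSinPi (((s - w : Fin N) : ℕ) / N))) :
    H.card * h ≤ deficiency E w := by
  rw [deficiency_eq_sum_univ, ← nsmul_eq_mul]
  refine (Finset.card_nsmul_le_sum H (fun s => if s ∈ E then
    max 0 (-logSinPi (((s - w : Fin N) : ℕ) / N)) else
      max 0 (logSinPi (((s - w : Fin N) : ℕ) / N))) h fun s hs => ?_).trans
    (Finset.sum_le_sum_of_subset_of_nonneg (Finset.subset_univ H) fun s _ _ => ?_)
  · rcases hH s hs with ⟨h1, h2⟩ | ⟨h1, h2⟩
    · rw [if_pos h1]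
      exact le_max_of_le_right (by linarith)
    · rw [if_neg h1]
      exact le_max_of_le_right h2
  · split_ifs <;> exact le_max_left _ _

/-- If all offsets in `[p, q)` lie on the wrong side by at least `h`, then the deficiency is at
least `h` times their number, and this persists after the removal of one point. -/
theorem le_deficiency_erase_of_window [NeZero N] {S : Finset (Fin N)} {w : Fin N} (z : Fin N)
    {p q h : ℝ} (hp : 0 ≤ p) (hq : q ≤ N) (h0 : 0 ≤ h)
    (hH : ∀ s : Fin N, p ≤ ((s - w : Fin N) : ℕ) → (((s - w : Fin N) : ℕ) : ℝ) < q →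
      (s ∈ S ∧ logSinPi (((s - w : Fin N) : ℕ) / N) ≤ -h) ∨
      (s ∉ S ∧ h ≤ logSinPi (((s - w : Fin N) : ℕ) / N))) :
    (q - p - 2) * h ≤ deficiency (S.erase z) w := by
  set H := Finset.univ.filter fun s : Fin N =>
    p ≤ ((s - w : Fin N) : ℕ) ∧ (((s - w : Fin N) : ℕ) : ℝ) < q with hHdef
  have hcard : q - p - 1 ≤ (H.card : ℝ) := by
    rw [hHdef, Fin.card_filter_val_sub (fun l => p ≤ l ∧ (l : ℝ) < q)]
    exact le_card_filter_range hq hp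
  have h1 : (H.card : ℝ) - 1 ≤ (H.erase z).card := by
    have := Finset.pred_card_le_card_erase (s := H) (a := z)
    have h2 : H.card ≤ (H.erase z).card + 1 := by omega
    have h3 : (H.card : ℝ) ≤ (H.erase z).card + 1 := by exact_mod_cast h2
    linarith
  refine le_trans ?_ (card_mul_le_deficiency (H := H.erase z) (h := h) fun s hs => ?_)
  · gcongr
    linarith
  · obtain ⟨hsz, hs⟩ := Finset.mem_erase.mp hs
    obtain ⟨-, hs1, hs2⟩ := Finset.mem_filter.mp hs
    rcases hH s hs1 hs2 with ⟨h3, h4⟩ | ⟨h3, h4⟩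
    · exact Or.inl ⟨Finset.mem_erase.mpr ⟨hsz, h3⟩, h4⟩
    · exact Or.inr ⟨fun h => h3 (Finset.mem_of_mem_erase h), h4⟩

/-- The best arc starts at offset `N/4` from `w`. If the start is displaced by `3ρ`, a window of
length at least `ρ/2` lies on the wrong side, where the potential has size at least `ρ/(2N)`. The
`-1/4` pays for rounding and for the erased point. -/
theorem le_deficiency_erase_finArc [NeZero N] {a w : Fin N} {n : ℕ} (hn : 0 < n)
    (hw : w ∉ finArc a n) (z : Fin N) :
    ((((a - w : Fin N) : ℕ) : ℝ) - N / 4) ^ 2 / (36 * N) - 1 / 4 ≤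
      deficiency ((finArc a n).erase z) w := by
  obtain ⟨ha0, haN⟩ := val_sub_add_le_of_notMem_finArc hn hw
  have hmem := mem_finArc_iff_of_notMem hw
  set α := ((a - w : Fin N) : ℕ)
  have hNpos : (0 : ℝ) < N := by exact_mod_cast NeZero.pos N
  have ha0' : (1 : ℝ) ≤ α := by exact_mod_cast ha0
  have haN' : (α : ℝ) + n ≤ N := by exact_mod_cast haN
  set y : ℝ := N / 4 with hy
  set ρ : ℝ := |(α : ℝ) - y| / 3 with hρ
  have hρ0 : 0 ≤ ρ := by positivity
  have hn0 : (0 : ℝ) ≤ n := Nat.cast_nonneg n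
  have hρN : ρ ≤ N / 4 := by
    rw [hρ]
    rcases abs_cases ((α : ℝ) - y) with ⟨h, _⟩ | ⟨h, _⟩ <;> rw [h] <;> linarith
  suffices h : (ρ / 2 - 2) * (ρ / (2 * N)) ≤ deficiency ((finArc a n).erase z) w by
    refine le_trans ?_ h
    have e1 : ((α : ℝ) - y) ^ 2 = 9 * ρ ^ 2 := by rw [hρ, div_pow, sq_abs]; ring
    have e2 : ρ / N ≤ 1 / 4 := by rw [div_le_iff₀ hNpos]; linarith
    have e3 : (ρ / 2 - 2) * (ρ / (2 * N)) = ρ ^ 2 / (4 * N) - ρ / N := by field_simp; ring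
    have e4 : 9 * ρ ^ 2 / (36 * N) = ρ ^ 2 / (4 * N) := by field_simp; ring
    rw [e1, e3, e4]
    linarith
  have hh0 : 0 ≤ ρ / (2 * N) := by positivity
  have hpos : ∀ l : ℕ, y + ρ / 2 ≤ l → (l : ℝ) < N / 2 → ρ / (2 * N) ≤ logSinPi (l / N) := by
    intro l h1 h2
    have := sub_le_logSinPi (x := l / N) (by rw [le_div_iff₀ hNpos]; linarith)
      (by rw [div_le_iff₀ hNpos]; linarith)
    have e : ρ / (2 * N) = ρ / 2 / N := by field_simp
    have e' : (l : ℝ) / N - 1 / 4 = (l - y) / N := by rw [hy]; field_simp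
    rw [e'] at this
    rw [e]
    refine le_trans ?_ this
    gcongr
    linarith
  -- If the arc starts too early, either it crosses `N/4` and contains offsets of negative
  -- potential, or it ends before `N/4` and misses all of `[3N/8, N/2)`. If it starts too late, it
  -- misses offsets just before `min α (N/2)`.
  rcases le_or_gt (α : ℝ) y with hαy | hαy
  · have h3ρ : y - α = 3 * ρ := by rw [hρ, abs_of_nonpos (by linarith)]; ring
    rcases lt_or_ge y (α + n) with hb | hb
    · refine le_trans ?_ (le_deficiency_erase_of_window (p := α) (q := (α + y) / 2) z
        (by positivity) (by linarith) hh0 fun s h1 h2 => Or.inl ⟨?_, ?_⟩)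
      · gcongr
        linarith
      · rw [hmem]
        refine ⟨by exact_mod_cast h1, ?_⟩
        have : (((s - w : Fin N) : ℕ) : ℝ) < α + n := by linarith
        exact_mod_cast this
      · set l := ((s - w : Fin N) : ℕ)
        have h5 := logSinPi_le_sub (x := l / N) (div_pos (by linarith) hNpos)
          (by rw [div_le_iff₀ hNpos]; linarith)
        refine h5.trans ?_
        have e : -(ρ / (2 * N)) = (-ρ / 2) / N := by field_simp
        have e' : (l : ℝ) / N - 1 / 4 = (l - y) / N := by rw [hy]; field_simp
        rw [e, e']
        gcongr
        linarith
    · refine le_trans ?_ (le_deficiency_erase_of_window (p := 3 * N / 8) (q := N / 2) z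
        (by positivity) (by linarith) hh0 fun s h1 h2 => Or.inr ⟨?_, ?_⟩)
      · gcongr
        linarith
      · rw [hmem, not_and, not_lt]
        intro _
        have : (α : ℝ) + n ≤ ((s - w : Fin N) : ℕ) := by linarith
        exact_mod_cast this
      · exact hpos _ (by linarith) h2
  · have h3ρ : α - y = 3 * ρ := by rw [hρ, abs_of_pos (by linarith)]; ring
    have hq : y + ρ ≤ min (α : ℝ) (N / 2) := le_min (by linarith) (by linarith)
    have hq1 := min_le_left (α : ℝ) (N / 2)
    have hq2 := min_le_right (α : ℝ) (N / 2)
    set q := min (α : ℝ) (N / 2)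
    refine le_trans ?_ (le_deficiency_erase_of_window (p := (q + y) / 2) (q := q) z
      (by linarith) (by linarith) hh0 fun s h1 h2 => Or.inr ⟨?_, ?_⟩)
    · gcongr
      linarith
    · rw [hmem, not_and_or, not_le]
      left
      have : (((s - w : Fin N) : ℕ) : ℝ) < α := by linarith
      exact_mod_cast this
    · exact hpos _ (by linarith) (by linarith)

/-- The arc differs from the optimal range `[N/4, 3N/4]` only within `R` of the two ends. Each end
has at most `2R + 1` offsets, and there the potential is at most `8R/N` in size. -/
theorem deficiency_finArc_le [NeZero N] {a w : Fin N} {n : ℕ}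
    (hw : w ∉ finArc a n) {R : ℝ} (hR : R ≤ N / 16)
    (h1 : |(((a - w : Fin N) : ℕ) : ℝ) - N / 4| ≤ R)
    (h2 : |(((a - w : Fin N) : ℕ) : ℝ) + n - 3 * N / 4| ≤ R) :
    deficiency (finArc a n) w ≤ 2 * (2 * R + 1) * (8 * R / N) := by
  have hmem := mem_finArc_iff_of_notMem hw
  set α := ((a - w : Fin N) : ℕ)
  have hNpos : (0 : ℝ) < N := by exact_mod_cast NeZero.pos N
  have hR0 : 0 ≤ R := (abs_nonneg _).trans h1
  rw [deficiency_eq_sum_univ]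
  have hclose : ∀ l : ℕ, |(l : ℝ) - N / 4| ≤ R → |logSinPi (l / N)| ≤ 8 * R / N := by
    intro l hl
    have e : (l : ℝ) / N - 1 / 4 = (l - N / 4) / N := by field_simp
    have e2 : |(l : ℝ) / N - 1 / 4| ≤ R / N := by
      rw [e, abs_div, abs_of_pos hNpos]
      gcongr
    have e3 : R / N ≤ 1 / 16 := by rw [div_le_iff₀ hNpos]; linarith
    refine (abs_logSinPi_le (e2.trans e3)).trans ?_
    rw [mul_div_assoc]
    gcongr
  have hclose' : ∀ l : ℕ, |(l : ℝ) - 3 * N / 4| ≤ R → |logSinPi (l / N)| ≤ 8 * R / N := by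
    intro l hl
    rw [← logSinPi_one_sub]
    have e : 1 - (l : ℝ) / N - 1 / 4 = -((l - 3 * N / 4) / N) := by field_simp; ring
    have e2 : |1 - (l : ℝ) / N - 1 / 4| ≤ R / N := by
      rw [e, abs_neg, abs_div, abs_of_pos hNpos]
      gcongr
    have e3 : R / N ≤ 1 / 16 := by rw [div_le_iff₀ hNpos]; linarith
    refine (abs_logSinPi_le (e2.trans e3)).trans ?_
    rw [mul_div_assoc]
    gcongr
  have hterm : ∀ s : Fin N, (if s ∈ finArc a n then
      max 0 (-logSinPi (((s - w : Fin N) : ℕ) / N)) else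
      max 0 (logSinPi (((s - w : Fin N) : ℕ) / N))) ≤
      (if |(((s - w : Fin N) : ℕ) : ℝ) - N / 4| ≤ R then 8 * R / N else 0) +
      (if |(((s - w : Fin N) : ℕ) : ℝ) - 3 * N / 4| ≤ R then 8 * R / N else 0) := by
    intro s
    have hlt : (((s - w : Fin N) : ℕ) : ℝ) ≤ N := by exact_mod_cast (s - w).2.le
    have hs : s ∈ finArc a n ↔ (α : ℝ) ≤ ((s - w : Fin N) : ℕ) ∧
        (((s - w : Fin N) : ℕ) : ℝ) < α + n := by
      rw [hmem]
      norm_cast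
    set l := ((s - w : Fin N) : ℕ)
    have hc : 0 ≤ 8 * R / N := by positivity
    have hcl := hclose l
    have hcl' := hclose' l
    rw [abs_le] at h1 h2
    by_cases hA : |(l : ℝ) - N / 4| ≤ R
    · have hu := abs_le.mp (hcl hA)
      rw [if_pos hA]
      refine le_trans (b := 8 * R / N) ?_ (le_add_of_nonneg_right (by split_ifs <;> simp [hc]))
      split_ifs
      · exact max_le hc (by linarith)
      · exact max_le hc (by linarith)
    · by_cases hB : |(l : ℝ) - 3 * N / 4| ≤ R
      · have hu := abs_le.mp (hcl' hB)
        rw [if_neg hA, if_pos hB, zero_add]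
        split_ifs
        · exact max_le hc (by linarith)
        · exact max_le hc (by linarith)
      · rw [if_neg hA, if_neg hB, add_zero]
        rw [abs_le, not_and_or, not_le, not_le] at hA hB
        have hl0 : (0 : ℝ) ≤ l := Nat.cast_nonneg l
        split_ifs with hin
        · rw [hs] at hin
          refine max_le le_rfl ?_
          rw [neg_nonpos]
          apply logSinPi_nonneg
          · rw [le_div_iff₀ hNpos]
            rcases hA with hA | hA <;> linarith
          · rw [div_le_iff₀ hNpos]
            rcases hB with hB | hB <;> linarith
        · rw [hs, not_and_or, not_le, not_lt] at hin
          refine max_le le_rfl ?_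
          rcases hin with hin | hin
          · apply logSinPi_nonpos (by positivity)
            rw [div_le_iff₀ hNpos]
            rcases hA with hA | hA <;> linarith
          · apply logSinPi_nonpos'
            · rw [le_div_iff₀ hNpos]
              rcases hB with hB | hB <;> linarith
            · rw [div_le_iff₀ hNpos]
              linarith
  refine (Finset.sum_le_sum fun s _ => hterm s).trans ?_
  have hc : 0 ≤ 8 * R / N := by positivity
  rw [Finset.sum_add_distrib, ← Finset.sum_filter, ← Finset.sum_filter, Finset.sum_const,
    Finset.sum_const, Fin.card_filter_val_sub (fun l => |(l : ℝ) - N / 4| ≤ R),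
    Fin.card_filter_val_sub (fun l => |(l : ℝ) - 3 * N / 4| ≤ R), nsmul_eq_mul, nsmul_eq_mul,
    mul_assoc, two_mul]
  gcongr
  · exact card_filter_abs_sub_le _ hR0
  · exact card_filter_abs_sub_le _ hR0

/-- The quadratic lower bound makes this a Gaussian sum. The erased point is left free so that the
bound serves both a fixed point of the arc and, with `z = id`, no erasure at all. -/
theorem sum_exp_neg_deficiency_erase_finArc_le [NeZero N] (a : Fin N) {n : ℕ} (hn : 0 < n)
    (z : Fin N → Fin N) :
    ∑ w ∈ (finArc a n)ᶜ, Real.exp (-2 * deficiency ((finArc a n).erase (z w)) w) ≤ 20 * √N := by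
  have hNpos : (0 : ℝ) < N := by exact_mod_cast NeZero.pos N
  calc ∑ w ∈ (finArc a n)ᶜ, Real.exp (-2 * deficiency ((finArc a n).erase (z w)) w)
      ≤ ∑ w ∈ (finArc a n)ᶜ, Real.exp (1 / 2) *
          Real.exp (-(((((a - w : Fin N) : ℕ) : ℝ) - N / 4) ^ 2 / (18 * N))) := by
        refine Finset.sum_le_sum fun w hw => ?_
        rw [← Real.exp_add, Real.exp_le_exp]
        have := le_deficiency_erase_finArc hn (Finset.mem_compl.mp hw) (z w)
        have e : ((((a - w : Fin N) : ℕ) : ℝ) - N / 4) ^ 2 / (18 * N) =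
            2 * (((((a - w : Fin N) : ℕ) : ℝ) - N / 4) ^ 2 / (36 * N)) := by
          field_simp
          ring
        rw [e]
        linarith
    _ ≤ ∑ w, Real.exp (1 / 2) *
          Real.exp (-(((((a - w : Fin N) : ℕ) : ℝ) - N / 4) ^ 2 / (18 * N))) :=
        Finset.sum_le_sum_of_subset_of_nonneg (Finset.subset_univ _) fun _ _ _ => by positivity
    _ = Real.exp (1 / 2) *
          ∑ l ∈ Finset.range N, Real.exp (-(((l : ℝ) - N / 4) ^ 2 / (18 * N))) := by
        rw [← Finset.mul_sum,
          Fin.sum_comp_sub_val (fun l => Real.exp (-(((l : ℝ) - N / 4) ^ 2 / (18 * N)))) a]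
    _ ≤ 2 * (10 * √N) := by
        gcongr
        · rw [← Real.le_log_iff_exp_le two_pos]
          linarith [Real.log_two_gt_d9]
        · exact sum_range_exp_neg_sq_le (NeZero.pos N)
    _ = 20 * √N := by ring

end Deficiency

/-! ### Roots of unity and products of their distances. -/

section Nodes

open Real

variable {N : ℕ}

/-- The `N`-th root of unity `exp (2πij/N)`. -/
noncomputable def fourierNode (j : Fin N) : ℂ :=
  Complex.exp (2 * (π : ℂ) * Complex.I * ((j : ℕ) : ℂ) / (N : ℂ))

theorem fourierMatrix_apply (j k : Fin N) : fourierMatrix N j k = fourierNode j ^ (k : ℕ) := by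
  rw [fourierNode, ← Complex.exp_nat_mul, fourierMatrix, Matrix.of_apply]
  congr 1
  ring

theorem fourierNode_pow_comm (j k : Fin N) :
    fourierNode j ^ (k : ℕ) = fourierNode k ^ (j : ℕ) := by
  rw [fourierNode, fourierNode, ← Complex.exp_nat_mul, ← Complex.exp_nat_mul]
  congr 1
  ring

theorem fourierNode_eq_exp_mul_I (j : Fin N) :
    fourierNode j = Complex.exp ((2 * π * (j : ℕ) / N : ℝ) * Complex.I) := by
  rw [fourierNode]
  push_cast
  congr 1
  ring

theorem norm_fourierNode (j : Fin N) : ‖fourierNode j‖ = 1 := by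
  rw [fourierNode_eq_exp_mul_I, Complex.norm_exp_ofReal_mul_I]

theorem fourierNode_ne_zero (j : Fin N) : fourierNode j ≠ 0 := Complex.exp_ne_zero _

theorem fourierNode_pow_card [NeZero N] (j : Fin N) : fourierNode j ^ N = 1 := by
  have hN : (N : ℂ) ≠ 0 := by exact_mod_cast NeZero.ne N
  rw [fourierNode, ← Complex.exp_nat_mul, mul_div_cancel₀ _ hN,
    show 2 * (π : ℂ) * Complex.I * ((j : ℕ) : ℂ) = ((j : ℕ) : ℂ) * (2 * π * Complex.I) by ring,
    Complex.exp_nat_mul_two_pi_mul_I]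

theorem fourierNode_pow_eq_mul_pow_sub [NeZero N] (j k t : Fin N) :
    fourierNode j ^ (k : ℕ) = fourierNode j ^ (t : ℕ) * fourierNode j ^ ((k - t : Fin N) : ℕ) := by
  rw [← pow_add]
  rcases Fin.val_sub_cases k t with ⟨h1, h2⟩ | ⟨h1, h2⟩
  · rw [h2, show (t : ℕ) + (k - t) = k by omega]
  · rw [h2, show (t : ℕ) + (N + k - t) = k + N by have := t.2; omega, pow_add,
      fourierNode_pow_card, mul_one]

theorem fourierNode_eq_mul_sub [NeZero N] (s w : Fin N) :
    fourierNode s = fourierNode w * fourierNode (s - w) := by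
  rcases Nat.lt_or_ge 1 N with h | h
  · have h1 : ∀ j : Fin N, fourierNode j = fourierNode (⟨1, h⟩ : Fin N) ^ (j : ℕ) := fun j => by
      rw [fourierNode_pow_comm]
      simp
    rw [h1 s, fourierNode_pow_eq_mul_pow_sub _ s w, ← h1, ← h1]
  · have : Subsingleton (Fin N) := by
      rw [Fin.subsingleton_iff_le_one]
      exact h
    have h0 : ∀ j : Fin N, fourierNode j = 1 := fun j => by
      have hj : (j : ℕ) = 0 := by have := j.2; omega
      simp [fourierNode, hj]
    simp [h0]

theorem norm_fourierNode_sub [NeZero N] (s w : Fin N) :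
    ‖fourierNode s - fourierNode w‖ = 2 * sin (π * (((s - w : Fin N) : ℕ) / N)) := by
  have hN : (0 : ℝ) < N := by exact_mod_cast NeZero.pos N
  have hl : (((s - w : Fin N) : ℕ) : ℝ) ≤ N := by exact_mod_cast (s - w).2.le
  rw [fourierNode_eq_mul_sub s w, ← mul_sub_one, norm_mul, norm_fourierNode, one_mul,
    fourierNode_eq_exp_mul_I, mul_comm _ Complex.I, Complex.norm_exp_I_mul_ofReal_sub_one,
    show 2 * π * (((s - w : Fin N) : ℕ) : ℝ) / N / 2 = π * (((s - w : Fin N) : ℕ) / N) by ring,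
    norm_of_nonneg]
  have : 0 ≤ sin (π * (((s - w : Fin N) : ℕ) / N)) := by
    apply sin_nonneg_of_nonneg_of_le_pi (by positivity)
    have : (((s - w : Fin N) : ℕ) : ℝ) / N ≤ 1 := by rwa [div_le_one hN]
    nlinarith [pi_pos]
  positivity

theorem Fin.val_sub_pos {s w : Fin N} (h : s ≠ w) : 0 < ((s - w : Fin N) : ℕ) := by
  have h' : (s : ℕ) ≠ w := fun e => h (Fin.ext e)
  have := w.2
  rcases Fin.val_sub_cases s w with ⟨h1, h2⟩ | ⟨h1, h2⟩ <;> omega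

theorem sin_pi_mul_val_sub_pos [NeZero N] {s w : Fin N} (h : s ≠ w) :
    0 < sin (π * (((s - w : Fin N) : ℕ) / N)) := by
  have hN : (0 : ℝ) < N := by exact_mod_cast NeZero.pos N
  have hl : (((s - w : Fin N) : ℕ) : ℝ) < N := by exact_mod_cast (s - w).2
  have hl0 : (0 : ℝ) < ((s - w : Fin N) : ℕ) := by exact_mod_cast Fin.val_sub_pos h
  apply sin_pos_of_pos_of_lt_pi (by positivity)
  have : (((s - w : Fin N) : ℕ) : ℝ) / N < 1 := by rwa [div_lt_one hN]
  nlinarith [pi_pos]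

theorem norm_fourierNode_sub_pos [NeZero N] {s w : Fin N} (h : s ≠ w) :
    0 < ‖fourierNode s - fourierNode w‖ := by
  rw [norm_fourierNode_sub]
  have := sin_pi_mul_val_sub_pos h
  positivity

theorem fourierNode_injective [NeZero N] : Function.Injective (fourierNode (N := N)) := by
  intro s w h
  by_contra hne
  have := norm_fourierNode_sub_pos hne
  simp [h] at this

theorem norm_fourierNode_sub_eq_exp [NeZero N] {s w : Fin N} (h : s ≠ w) :
    ‖fourierNode s - fourierNode w‖ =
      exp (log 2 / 2 + logSinPi (((s - w : Fin N) : ℕ) / N)) := by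
  have h1 := sin_pi_mul_val_sub_pos h
  have h2 : (0 : ℝ) < √2 := by positivity
  rw [norm_fourierNode_sub, exp_add, logSinPi, exp_log (by positivity), ← log_sqrt zero_le_two,
    exp_log h2, ← mul_assoc, mul_self_sqrt zero_le_two]

theorem prod_norm_fourierNode_sub [NeZero N] {E : Finset (Fin N)} {w : Fin N} (hw : w ∉ E) :
    ∏ s ∈ E, ‖fourierNode s - fourierNode w‖ = exp (E.card * (log 2 / 2) +
      ∑ l ∈ Finset.range N, max 0 (logSinPi (l / N)) - deficiency E w) := by
  rw [Finset.prod_congr rfl fun s hs => norm_fourierNode_sub_eq_exp (ne_of_mem_of_not_mem hs hw),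
    ← exp_sum, Finset.sum_add_distrib, sum_logSinPi_eq_sub_deficiency, Finset.sum_const,
    nsmul_eq_mul, add_sub_assoc]

/-- Rotate `z` to `1` and use `∏ (1 - ζ^k) = N` over the nontrivial roots of unity. -/
theorem prod_erase_norm_fourierNode_sub [NeZero N] (z : Fin N) :
    ∏ s ∈ Finset.univ.erase z, ‖fourierNode s - fourierNode z‖ = N := by
  obtain ⟨n, rfl⟩ : ∃ n, N = n + 1 := ⟨N - 1, by have := NeZero.pos N; omega⟩
  have hprim : IsPrimitiveRoot (Complex.exp (2 * π * Complex.I / (n + 1 : ℕ))) (n + 1) :=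
    Complex.isPrimitiveRoot_exp (n + 1) (Nat.succ_ne_zero n)
  have h := congrArg norm hprim.prod_one_sub_pow_eq_order
  rw [norm_prod] at h
  have h1 : ∏ s ∈ Finset.univ.erase z, ‖fourierNode s - fourierNode z‖ =
      ∏ s ∈ Finset.univ.erase (0 : Fin (n + 1)), ‖fourierNode s - 1‖ := by
    refine Finset.prod_bij (fun s _ => s - z) (fun s hs => ?_) (fun s _ t _ hst => ?_)
      (fun s hs => ⟨s + z, ?_, ?_⟩) (fun s hs => ?_)
    · simpa [sub_eq_zero] using hs
    · simpa using hst
    · simpa using hs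
    · simp
    · rw [fourierNode_eq_mul_sub s z, ← mul_sub_one, norm_mul, norm_fourierNode, one_mul]
  have h2 : ∏ s ∈ Finset.univ.erase (0 : Fin (n + 1)), ‖fourierNode s - 1‖ =
      ∏ k ∈ Finset.range n,
        ‖1 - Complex.exp (2 * π * Complex.I / (n + 1 : ℕ)) ^ (k + 1)‖ := by
    rw [← Fin.prod_univ_eq_prod_range
      (fun k => ‖1 - Complex.exp (2 * π * Complex.I / (n + 1 : ℕ)) ^ (k + 1)‖)]
    symm
    refine Finset.prod_bij (fun s _ => Fin.succ s) (fun s hs => ?_) (fun s _ t _ hst => ?_)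
      (fun s hs => ?_) (fun s hs => ?_)
    · simp [Fin.succ_ne_zero]
    · simpa using hst
    · obtain ⟨t, rfl⟩ := Fin.exists_succ_eq.mpr (Finset.ne_of_mem_erase hs)
      exact ⟨t, Finset.mem_univ _, rfl⟩
    · rw [norm_sub_rev, fourierNode, ← Complex.exp_nat_mul]
      congr 3
      rw [Fin.val_succ]
      ring
  rw [h1, h2, h]
  norm_cast

end Nodes

/-! ### Size of the Lagrange basis at the nodes. -/

section Lagrange

open Real

variable {N : ℕ}

/-- The modulus at the node `w` of the Lagrange basis polynomial of the nodes `S` at `z ∈ S`. -/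
noncomputable def lagrangeWeight (S : Finset (Fin N)) (z w : Fin N) : ℝ :=
  ‖(Lagrange.basis S fourierNode z).eval (fourierNode w)‖

/-- The denominator, a product over `S \ {z}`, is `N` divided by the complementary product over
`Sᶜ`. Both remaining products can then be bounded above in the same way. -/
theorem lagrangeWeight_eq [NeZero N] {S : Finset (Fin N)} {z w : Fin N} (hz : z ∈ S) :
    lagrangeWeight S z w = (∏ s ∈ S.erase z, ‖fourierNode s - fourierNode w‖) *
      (∏ s ∈ Sᶜ, ‖fourierNode s - fourierNode z‖) / N := by
  have hN : (N : ℝ) ≠ 0 := by exact_mod_cast NeZero.ne N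
  have h1 : (∏ s ∈ S.erase z, ‖fourierNode s - fourierNode z‖) *
      ∏ s ∈ Sᶜ, ‖fourierNode s - fourierNode z‖ = N := by
    rw [← prod_erase_norm_fourierNode_sub z, ← Finset.prod_union]
    · congr 1
      ext s
      by_cases hs : s = z <;> simp [hs, hz, em]
    · rw [Finset.disjoint_left]
      intro s hs hs'
      exact Finset.mem_compl.mp hs' (Finset.mem_of_mem_erase hs)
  have h2 : lagrangeWeight S z w = (∏ s ∈ S.erase z, ‖fourierNode s - fourierNode w‖) /
      ∏ s ∈ S.erase z, ‖fourierNode s - fourierNode z‖ := by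
    rw [lagrangeWeight, Lagrange.basis, Polynomial.eval_prod, norm_prod, ← Finset.prod_div_distrib]
    refine Finset.prod_congr rfl fun s hs => ?_
    rw [Lagrange.basisDivisor]
    simp only [Polynomial.eval_mul, Polynomial.eval_C, Polynomial.eval_sub, Polynomial.eval_X,
      norm_mul, norm_inv]
    rw [norm_sub_rev (fourierNode z), norm_sub_rev (fourierNode w), div_eq_inv_mul]
  have h3 : ∏ s ∈ S.erase z, ‖fourierNode s - fourierNode z‖ ≠ 0 := by
    intro h
    rw [h, zero_mul] at h1
    exact hN h1.symm
  rw [h2, div_eq_div_iff h3 hN, ← h1]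
  ring

theorem lagrangeWeight_le [NeZero N] {S : Finset (Fin N)} {z w : Fin N} (hz : z ∈ S)
    (hw : w ∉ S) : lagrangeWeight S z w ≤ 4 / N * exp (2 * catalanConstant * N / π) *
      (exp (-deficiency (S.erase z) w) * exp (-deficiency Sᶜ z)) := by
  have hN : (0 : ℝ) < N := by exact_mod_cast NeZero.pos N
  have hsum := (abs_le.mp (abs_sum_range_max_logSinPi_sub_le N)).2
  rw [lagrangeWeight_eq hz, prod_norm_fourierNode_sub (fun h => hw (Finset.mem_of_mem_erase h)),
    prod_norm_fourierNode_sub (fun h => Finset.mem_compl.mp h hz), ← exp_add, ← exp_add,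
    div_mul_eq_mul_div, div_mul_eq_mul_div]
  gcongr
  rw [← log_le_log_iff (by positivity) (by positivity), log_exp, mul_assoc, ← exp_add,
    log_mul (by norm_num) (exp_ne_zero _), log_exp, show (4 : ℝ) = 2 ^ 2 by norm_num, log_pow]
  have hc1 : ((S.erase z).card : ℝ) + 1 + Sᶜ.card = N := by
    have h1 := Finset.card_erase_add_one hz
    have h2 := Finset.card_add_card_compl S
    rw [Fintype.card_fin] at h2
    rw [← h1] at h2
    exact_mod_cast h2
  have e1 : 2 * catalanConstant * N / π = 2 * (N * (catalanConstant / π)) := by ring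
  have hl : 0 < log 2 := log_pos one_lt_two
  -- There are `N - 1` distances in total, so their `log 2 / 2` terms cancel the `-log 2 / 4` in the
  -- two sums of positive parts. The two Riemann sum errors of `log 2` give the factor `4`.
  have e2 : ((S.erase z).card : ℝ) * (log 2 / 2) + (Sᶜ.card : ℝ) * (log 2 / 2) =
      (N - 1) * (log 2 / 2) := by
    rw [← hc1]; ring
  rw [e1]
  push_cast
  nlinarith

theorem le_lagrangeWeight [NeZero N] {S : Finset (Fin N)} {z w : Fin N} (hz : z ∈ S)
    (hw : w ∉ S) : 1 / (8 * N) * exp (2 * catalanConstant * N / π) *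
      (exp (-deficiency S w) * exp (-deficiency Sᶜ z)) ≤ lagrangeWeight S z w := by
  have hN : (0 : ℝ) < N := by exact_mod_cast NeZero.pos N
  have hsum := (abs_le.mp (abs_sum_range_max_logSinPi_sub_le N)).1
  have hzw : z ≠ w := ne_of_mem_of_not_mem hz hw
  have hd := norm_fourierNode_sub_pos hzw
  have hd2 : ‖fourierNode z - fourierNode w‖ ≤ 2 := by
    refine (norm_sub_le _ _).trans ?_
    rw [norm_fourierNode, norm_fourierNode]
    norm_num
  -- Restoring the missing factor, at most `2`, replaces `S.erase z` by the arc-friendly `S`.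
  have hmul : (∏ s ∈ S, ‖fourierNode s - fourierNode w‖) ≤
      2 * ∏ s ∈ S.erase z, ‖fourierNode s - fourierNode w‖ := by
    rw [← Finset.mul_prod_erase S (fun s => ‖fourierNode s - fourierNode w‖) hz]
    exact mul_le_mul_of_nonneg_right hd2 (Finset.prod_nonneg fun _ _ => norm_nonneg _)
  have hmain : 1 / 4 * exp (2 * catalanConstant * N / π) *
      (exp (-deficiency S w) * exp (-deficiency Sᶜ z)) ≤
      (∏ s ∈ S, ‖fourierNode s - fourierNode w‖) *
        ∏ s ∈ Sᶜ, ‖fourierNode s - fourierNode z‖ := by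
    rw [prod_norm_fourierNode_sub hw,
      prod_norm_fourierNode_sub (fun h => Finset.mem_compl.mp h hz), ← exp_add, ← exp_add,
      ← log_le_log_iff (by positivity) (by positivity), log_exp, mul_assoc, ← exp_add,
      log_mul (by norm_num) (exp_ne_zero _), log_exp, one_div, log_inv,
      show (4 : ℝ) = 2 ^ 2 by norm_num, log_pow]
    have hc1 : (S.card : ℝ) + Sᶜ.card = N := by
      have h2 := Finset.card_add_card_compl S
      rw [Fintype.card_fin] at h2
      exact_mod_cast h2
    have e1 : 2 * catalanConstant * N / π = 2 * (N * (catalanConstant / π)) := by ring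
    have e2 : (S.card : ℝ) * (log 2 / 2) + (Sᶜ.card : ℝ) * (log 2 / 2) = N * (log 2 / 2) := by
      rw [← hc1]; ring
    rw [e1]
    push_cast
    nlinarith
  have hQ : 0 ≤ ∏ s ∈ Sᶜ, ‖fourierNode s - fourierNode z‖ :=
    Finset.prod_nonneg fun _ _ => norm_nonneg _
  have h4 := mul_le_mul_of_nonneg_right hmul hQ
  rw [lagrangeWeight_eq hz, le_div_iff₀ hN]
  have e : 1 / (8 * N) * exp (2 * catalanConstant * N / π) *
      (exp (-deficiency S w) * exp (-deficiency Sᶜ z)) * N =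
      1 / 2 * (1 / 4 * exp (2 * catalanConstant * N / π) *
      (exp (-deficiency S w) * exp (-deficiency Sᶜ z))) := by
    field_simp
    ring
  rw [e]
  linarith

end Lagrange

/-! ### Exponential sums as polynomials, Parseval and interpolation. -/

section FourierSum

open Polynomial

variable {N : ℕ}

/-- The value at the node `w` of the exponential sum with frequencies in `T` and coefficients `x`. -/
noncomputable def fourierSum {T : Finset (Fin N)} (x : T → ℂ) (w : Fin N) : ℂ :=
  ∑ k : T, x k * fourierNode w ^ ((k : Fin N) : ℕ)

theorem toEuclideanLin_fourierSubmatrix_apply {S T : Finset (Fin N)} (x : EuclideanSpace ℂ T)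
    (j : S) : Matrix.toEuclideanLin (fourierSubmatrix S T) x j = fourierSum x j := by
  rw [Matrix.toLpLin_apply]
  simp only [Matrix.mulVec, dotProduct, fourierSum, fourierSubmatrix, Matrix.submatrix_apply,
    fourierMatrix_apply]
  exact Finset.sum_congr rfl fun k _ => mul_comm _ _

theorem norm_toEuclideanLin_fourierSubmatrix_sq {S T : Finset (Fin N)} (x : EuclideanSpace ℂ T) :
    ‖Matrix.toEuclideanLin (fourierSubmatrix S T) x‖ ^ 2 = ∑ j ∈ S, ‖fourierSum x j‖ ^ 2 := by
  rw [EuclideanSpace.norm_sq_eq, ← Finset.sum_coe_sort S]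
  exact Finset.sum_congr rfl fun j _ => by rw [toEuclideanLin_fourierSubmatrix_apply]

theorem sum_fourierNode_mul_conj [NeZero N] (k l : Fin N) :
    ∑ j : Fin N, fourierNode j ^ (k : ℕ) * (starRingEnd ℂ) (fourierNode j ^ (l : ℕ)) =
      if k = l then (N : ℂ) else 0 := by
  have h : ∀ j : Fin N, fourierNode j ^ (k : ℕ) * (starRingEnd ℂ) (fourierNode j ^ (l : ℕ)) =
      fourierNode (k - l) ^ (j : ℕ) := by
    intro j
    rw [fourierNode_pow_comm j k, fourierNode_pow_comm j l, fourierNode_eq_mul_sub k l, mul_pow,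
      mul_right_comm, Complex.mul_conj', norm_pow, norm_fourierNode]
    simp
  rw [Finset.sum_congr rfl fun j _ => h j,
    Fin.sum_univ_eq_sum_range (fun j => fourierNode (k - l) ^ j)]
  split_ifs with hkl
  · subst hkl
    simp [fourierNode]
  · have hne : fourierNode (k - l) - 1 ≠ 0 := by
      have := norm_fourierNode_sub_pos hkl
      rw [fourierNode_eq_mul_sub k l, ← mul_sub_one, norm_mul, norm_fourierNode, one_mul] at this
      exact norm_pos_iff.mp this
    have h2 := geom_sum_mul (fourierNode (k - l)) N
    rw [fourierNode_pow_card, sub_self] at h2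
    exact (mul_eq_zero.mp h2).resolve_right hne

theorem sum_norm_fourierSum_sq [NeZero N] {T : Finset (Fin N)} (x : T → ℂ) :
    ∑ w, ‖fourierSum x w‖ ^ 2 = N * ∑ k, ‖x k‖ ^ 2 := by
  apply Complex.ofReal_injective
  push_cast
  have h : ∀ w : Fin N, ((‖fourierSum x w‖ : ℂ)) ^ 2 = ∑ k : T, ∑ l : T,
      x k * (starRingEnd ℂ) (x l) * (fourierNode w ^ ((k : Fin N) : ℕ) *
        (starRingEnd ℂ) (fourierNode w ^ ((l : Fin N) : ℕ))) := by
    intro w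
    rw [← Complex.mul_conj', fourierSum, map_sum, Finset.sum_mul_sum]
    refine Finset.sum_congr rfl fun k _ => Finset.sum_congr rfl fun l _ => ?_
    rw [map_mul]
    ring
  rw [Finset.sum_congr rfl fun w _ => h w, Finset.sum_comm, Finset.mul_sum]
  refine Finset.sum_congr rfl fun k _ => ?_
  rw [Finset.sum_comm, Finset.sum_eq_single k]
  · rw [← Finset.mul_sum, sum_fourierNode_mul_conj, if_pos rfl, Complex.mul_conj', mul_comm]
  · intro l _ hl
    rw [← Finset.mul_sum, sum_fourierNode_mul_conj, if_neg fun h => hl (Subtype.ext h.symm),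
      mul_zero]
  · simp

/-- At `N`-th roots of unity exponents matter only modulo `N`, so pulling out the power `t` leaves
exponents below `n` even when the arc wraps around. Only here is contiguity of `T` essential for the
upper bounds. -/
theorem fourierSum_eq_eval [NeZero N] {t : Fin N} {n : ℕ} (x : finArc t n → ℂ) :
    ∃ p : ℂ[X], p.degree < n ∧
      ∀ w, fourierSum x w = fourierNode w ^ (t : ℕ) * p.eval (fourierNode w) := by
  refine ⟨∑ k : finArc t n, C (x k) * X ^ (((k : Fin N) - t : Fin N) : ℕ), ?_, fun w => ?_⟩
  · rw [← mem_degreeLT]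
    refine Submodule.sum_mem _ fun k _ => mem_degreeLT.mpr ?_
    refine (degree_C_mul_X_pow_le _ _).trans_lt ?_
    exact_mod_cast mem_finArc.mp k.2
  · rw [eval_finsetSum, Finset.mul_sum, fourierSum]
    refine Finset.sum_congr rfl fun k _ => ?_
    rw [fourierNode_pow_eq_mul_pow_sub w k t]
    simp only [eval_mul, eval_C, eval_pow, eval_X]
    ring

theorem exists_fourierSum_eq_eval [NeZero N] (t : Fin N) {n : ℕ} (hn0 : 0 < n) (hn : n ≤ N) (p : ℂ[X])
    (hp : p.degree < n) : ∃ x : finArc t n → ℂ,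
      ∀ w, fourierSum x w = fourierNode w ^ (t : ℕ) * p.eval (fourierNode w) := by
  refine ⟨fun k => p.coeff (((k : Fin N) - t : Fin N) : ℕ), fun w => ?_⟩
  have h1 : fourierSum (fun k : finArc t n => p.coeff (((k : Fin N) - t : Fin N) : ℕ)) w =
      fourierNode w ^ (t : ℕ) * ∑ k ∈ finArc t n,
        p.coeff ((k - t : Fin N) : ℕ) * fourierNode w ^ ((k - t : Fin N) : ℕ) := by
    rw [fourierSum, Finset.sum_coe_sort (finArc t n) (fun k =>
      p.coeff ((k - t : Fin N) : ℕ) * fourierNode w ^ (k : ℕ)), Finset.mul_sum]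
    refine Finset.sum_congr rfl fun k _ => ?_
    rw [fourierNode_pow_eq_mul_pow_sub w k t]
    ring
  rw [h1, finArc, Finset.sum_filter,
    Fin.sum_comp_val_sub (fun l => if l < n then p.coeff l * fourierNode w ^ l else 0),
    ← Finset.sum_filter]
  have h2 : (Finset.range N).filter (fun l => l < n) = Finset.range n := by
    ext l
    simp only [Finset.mem_filter, Finset.mem_range]
    omega
  have hdeg : p.natDegree < n := by
    by_cases h0 : p = 0
    · simpa [h0] using hn0
    · exact (natDegree_lt_iff_degree_lt h0).mpr hp
  rw [h2, eval_eq_sum_range' hdeg]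

theorem norm_fourierSum_sq_le [NeZero N] {S : Finset (Fin N)} {t : Fin N}
    (x : finArc t S.card → ℂ) (w : Fin N) :
    ‖fourierSum x w‖ ^ 2 ≤
      (∑ z ∈ S, lagrangeWeight S z w ^ 2) * ∑ z ∈ S, ‖fourierSum x z‖ ^ 2 := by
  obtain ⟨p, hp, hx⟩ := fourierSum_eq_eval x
  have hnorm : ∀ w, ‖fourierSum x w‖ = ‖p.eval (fourierNode w)‖ := fun w => by
    rw [hx, norm_mul, norm_pow, norm_fourierNode, one_pow, one_mul]
  have hle : ‖fourierSum x w‖ ≤ ∑ z ∈ S, lagrangeWeight S z w * ‖fourierSum x z‖ := by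
    rw [hnorm, Lagrange.eq_interpolate fourierNode_injective.injOn hp, Lagrange.interpolate_apply,
      eval_finsetSum]
    refine (norm_sum_le _ _).trans (Finset.sum_le_sum fun z _ => ?_)
    rw [eval_mul, eval_C, norm_mul, hnorm, mul_comm, lagrangeWeight]
  calc ‖fourierSum x w‖ ^ 2 ≤ (∑ z ∈ S, lagrangeWeight S z w * ‖fourierSum x z‖) ^ 2 := by
        gcongr
    _ ≤ _ := Finset.sum_mul_sq_le_sq_mul_sq _ _ _

/-- By Parseval the left side is the sum over all nodes: those in `S` account for the `1`, the
others are controlled by interpolation and Cauchy–Schwarz. -/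
theorem card_mul_sum_norm_sq_le [NeZero N] {S : Finset (Fin N)} {t : Fin N}
    (x : finArc t S.card → ℂ) :
    N * ∑ k, ‖x k‖ ^ 2 ≤ (1 + ∑ w ∈ Sᶜ, ∑ z ∈ S, lagrangeWeight S z w ^ 2) *
      ∑ z ∈ S, ‖fourierSum x z‖ ^ 2 := by
  rw [← sum_norm_fourierSum_sq, ← Finset.sum_add_sum_compl S, add_mul, one_mul, Finset.sum_mul]
  gcongr with w _
  exact norm_fourierSum_sq_le x w

end FourierSum

/-! ### Bounds for the extreme singular values. -/

section SigmaBounds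

variable {N : ℕ}

theorem sigmaMax_fourierSubmatrix_le [NeZero N] (S T : Finset (Fin N)) :
    sigmaMax (fourierSubmatrix S T) ≤ √N := by
  refine LinearMap.singularValues_le_of_norm_apply_le _ (Real.sqrt_nonneg _) (fun x => ?_) 0
  refine le_of_sq_le_sq ?_ (by positivity)
  rw [norm_toEuclideanLin_fourierSubmatrix_sq, mul_pow, Real.sq_sqrt (Nat.cast_nonneg N),
    EuclideanSpace.norm_sq_eq, ← sum_norm_fourierSum_sq]
  exact Finset.sum_le_sum_of_subset_of_nonneg (Finset.subset_univ S) fun _ _ _ => by positivity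

theorem sqrt_card_le_sigmaMax [NeZero N] {S T : Finset (Fin N)} (hS : S.Nonempty) :
    √T.card ≤ sigmaMax (fourierSubmatrix S T) := by
  obtain ⟨j, hj⟩ := hS
  set x : EuclideanSpace ℂ T := WithLp.toLp 2 fun k : T =>
    (starRingEnd ℂ) (fourierNode j ^ ((k : Fin N) : ℕ)) with hx
  have hxn : ‖x‖ ^ 2 = T.card := by
    rw [EuclideanSpace.norm_sq_eq]
    simp [hx, norm_fourierNode]
  have hxj : fourierSum x j = T.card := by
    rw [fourierSum]
    simp only [hx, mul_comm ((starRingEnd ℂ) _), Complex.mul_conj', norm_pow, norm_fourierNode]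
    simp
  have h1 := LinearMap.norm_apply_le_singularValues_zero
    (Matrix.toEuclideanLin (fourierSubmatrix S T)) x
  have h2 : (T.card : ℝ) ^ 2 ≤ ‖Matrix.toEuclideanLin (fourierSubmatrix S T) x‖ ^ 2 := by
    rw [norm_toEuclideanLin_fourierSubmatrix_sq]
    refine le_trans (le_of_eq ?_)
      (Finset.single_le_sum (f := fun j => ‖fourierSum x j‖ ^ 2) (fun _ _ => by positivity) hj)
    rw [hxj]
    simp
  have h3 : (T.card : ℝ) ≤ sigmaMax (fourierSubmatrix S T) * ‖x‖ :=
    (le_of_sq_le_sq h2 (norm_nonneg _)).trans h1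
  have hxs : ‖x‖ = √T.card := by rw [← hxn, Real.sqrt_sq (norm_nonneg x)]
  rw [hxs] at h3
  rcases (Nat.cast_nonneg (α := ℝ) T.card).eq_or_lt with h | h
  · rw [← h, Real.sqrt_zero]
    exact LinearMap.singularValues_nonneg _ _
  · refine le_of_mul_le_mul_right ?_ (Real.sqrt_pos.mpr h)
    rwa [Real.mul_self_sqrt h.le]

/-- Vectors supported on `T'` form a test space of dimension `min |S| |T|` for the min-max
principle, and restoring the rows outside `S'` only increases the norm. This reduces rectangular
submatrices to square ones. -/
theorem sqrt_div_le_sigmaMin [NeZero N] {S T S' T' : Finset (Fin N)} (hS : S' ⊆ S) (hT : T' ⊆ T)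
    (hT' : T'.card = min S.card T.card) (hpos : 0 < T'.card) {B : ℝ} (hB : 0 < B)
    (h : ∀ x : T' → ℂ, N * ∑ k, ‖x k‖ ^ 2 ≤ B * ∑ z ∈ S', ‖fourierSum x z‖ ^ 2) :
    √(N / B) ≤ sigmaMin (fourierSubmatrix S T) := by
  let ext : EuclideanSpace ℂ T' →ₗ[ℂ] EuclideanSpace ℂ T :=
    { toFun := fun x => WithLp.toLp 2 fun k : T => if h : (k : Fin N) ∈ T' then x ⟨k, h⟩ else 0
      map_add' := fun x y => by
        ext k
        by_cases h : (k : Fin N) ∈ T' <;> simp [h]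
      map_smul' := fun c x => by
        ext k
        by_cases h : (k : Fin N) ∈ T' <;> simp [h] }
  have hext : ∀ x k, ext x k = if h : (k : Fin N) ∈ T' then x ⟨k, h⟩ else 0 := fun _ _ => rfl
  have hsum : ∀ {M : Type} [AddCommMonoid M] (g : T → M) (g' : T' → M),
      (∀ (k : T) (hk : (k : Fin N) ∈ T'), g k = g' ⟨k, hk⟩) → (∀ k : T, (k : Fin N) ∉ T' → g k = 0) →
      ∑ k, g k = ∑ k, g' k := by
    intro M _ g g' h1 h2
    symm
    refine Finset.sum_of_injOn (fun k : T' => (⟨k, hT k.2⟩ : T)) ?_ (by simp) ?_ ?_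
    · intro a _ b _ hab
      exact Subtype.ext (congrArg (fun k : T => (k : Fin N)) hab)
    · intro k _ hk
      refine h2 k fun hk' => hk ?_
      exact ⟨⟨k, hk'⟩, by simp, rfl⟩
    · intro k _
      exact (h1 ⟨k, hT k.2⟩ k.2).symm
  have hnorm : ∀ x, ‖ext x‖ ^ 2 = ∑ k, ‖x k‖ ^ 2 := fun x => by
    rw [EuclideanSpace.norm_sq_eq]
    refine hsum _ _ (fun k hk => ?_) (fun k hk => ?_)
    · rw [hext, dif_pos hk]
    · rw [hext, dif_neg hk]
      simp
  have hfs : ∀ x w, fourierSum (ext x) w = fourierSum x w := fun x w => by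
    refine hsum _ _ (fun k hk => ?_) (fun k hk => ?_)
    · rw [hext, dif_pos hk]
    · rw [hext, dif_neg hk, zero_mul]
  have hinj : Function.Injective ext := by
    rw [← LinearMap.ker_eq_bot, LinearMap.ker_eq_bot']
    intro x hx
    have := hnorm x
    rw [hx, norm_zero, ← EuclideanSpace.norm_sq_eq] at this
    exact norm_eq_zero.mp (by nlinarith [norm_nonneg x])
  refine LinearMap.le_singularValues_of_submodule _ (LinearMap.range ext) ?_ ?_
  · rw [LinearMap.finrank_range_of_inj hinj, finrank_euclideanSpace, Fintype.card_coe,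
      Fintype.card_coe, Fintype.card_coe]
    omega
  · rintro _ ⟨x, rfl⟩
    refine le_of_sq_le_sq ?_ (norm_nonneg _)
    rw [mul_pow, Real.sq_sqrt (by positivity), hnorm, norm_toEuclideanLin_fourierSubmatrix_sq,
      div_mul_eq_mul_div, div_le_iff₀ hB, mul_comm _ B]
    refine (h x).trans ?_
    gcongr
    refine (Finset.sum_le_sum_of_subset_of_nonneg hS fun _ _ _ => by positivity).trans_eq ?_
    exact Finset.sum_congr rfl fun w _ => by rw [hfs]

theorem sigmaMin_sq_mul_le {S T : Finset (Fin N)} (hST : S.card = T.card)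
    (x : T → ℂ) :
    sigmaMin (fourierSubmatrix S T) ^ 2 * ∑ k, ‖x k‖ ^ 2 ≤ ∑ z ∈ S, ‖fourierSum x z‖ ^ 2 := by
  have h := LinearMap.singularValues_finrank_sub_one_mul_norm_le
    (Matrix.toEuclideanLin (fourierSubmatrix S T)) (WithLp.toLp 2 x)
  rw [finrank_euclideanSpace, Fintype.card_coe] at h
  have h2 := pow_le_pow_left₀ (mul_nonneg (LinearMap.singularValues_nonneg _ _) (norm_nonneg _)) h 2
  rw [norm_toEuclideanLin_fourierSubmatrix_sq, mul_pow, EuclideanSpace.norm_sq_eq] at h2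
  rw [sigmaMin, matrixSingularValue, Fintype.card_coe, Fintype.card_coe, hST, min_self]
  exact h2

end SigmaBounds

/-! ### Phase alignment and the upper bound for the least singular value. -/

section Phases

open Polynomial

variable {N : ℕ}

/-- A square root of `fourierNode s / fourierNode a` depending on the offset of `s` from `a`. -/
noncomputable def halfNode (a s : Fin N) : ℂ :=
  Complex.exp ((Real.pi * (((s - a : Fin N) : ℕ) / N) : ℝ) * Complex.I)

/-- Half-angle identity `e^{2iA} - e^{2iB} = 2i e^{i(A+B)} sin (A - B)`: apart from a real sine, the
difference splits into a factor in `w` and a factor in `z`. -/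
theorem fourierNode_sub_eq_halfNode [NeZero N] (a w z : Fin N) :
    fourierNode w - fourierNode z = fourierNode a * halfNode a w * halfNode a z *
      (2 * Complex.I) * ((Real.sin (Real.pi * ((((w - a : Fin N) : ℕ) : ℝ) -
        ((z - a : Fin N) : ℕ)) / N) : ℝ) : ℂ) := by
  have hsq : ∀ s, fourierNode s = fourierNode a * halfNode a s ^ 2 := fun s => by
    rw [fourierNode_eq_mul_sub s a, fourierNode_eq_exp_mul_I (s - a), halfNode, ← Complex.exp_nat_mul]
    congr 2
    push_cast
    ring
  rw [hsq w, hsq z]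
  set A : ℝ := Real.pi * (((w - a : Fin N) : ℕ) / N) with hA
  set B : ℝ := Real.pi * (((z - a : Fin N) : ℕ) / N) with hB
  rw [show Real.pi * ((((w - a : Fin N) : ℕ) : ℝ) - ((z - a : Fin N) : ℕ)) / N = A - B by
    rw [hA, hB]; ring, Complex.ofReal_sin, Complex.sin]
  have hw : halfNode a w = Complex.exp (A * Complex.I) := rfl
  have hz : halfNode a z = Complex.exp (B * Complex.I) := rfl
  rw [hw, hz]
  push_cast
  rw [show -((A : ℂ) - B) * Complex.I = B * Complex.I - A * Complex.I by ring,
    show ((A : ℂ) - B) * Complex.I = A * Complex.I - B * Complex.I by ring,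
    Complex.exp_sub, Complex.exp_sub]
  have h1 := Complex.exp_ne_zero (A * Complex.I)
  have h2 := Complex.exp_ne_zero (B * Complex.I)
  field_simp
  rw [Complex.I_sq]
  ring

/-- For the nodes of an arc, the values of the Lagrange basis polynomials outside of the arc
can be aligned by phases that do not depend on the point of evaluation. -/
theorem exists_phases_norm_sum_basis [NeZero N] (a : Fin N) (n : ℕ) :
    ∃ d : Fin N → ℂ, (∀ z ∈ finArc a n, ‖d z‖ = 1) ∧ ∀ w ∉ finArc a n, ∀ Z ⊆ finArc a n,
      ‖∑ z ∈ Z, d z * (Lagrange.basis (finArc a n) fourierNode z).eval (fourierNode w)‖ =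
        ∑ z ∈ Z, lagrangeWeight (finArc a n) z w := by
  set S := finArc a n
  have hNpos : (0 : ℝ) < N := by exact_mod_cast NeZero.pos N
  -- In barycentric form, `ℓ_z(w)` is a factor in `w` times `μ z` over a sine. Counted from `a`,
  -- every `w` outside the arc comes after every `z` inside, so the sine is positive and the
  -- conjugate phase of `μ z` aligns the terms for all `w` at once.
  set μ : Fin N → ℂ := fun z => Lagrange.nodalWeight S fourierNode z / halfNode a z with hμ
  have hhalf : ∀ s, halfNode a s ≠ 0 := fun s => Complex.exp_ne_zero _
  have hμ0 : ∀ z ∈ S, μ z ≠ 0 := fun z hz =>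
    div_ne_zero (Lagrange.nodalWeight_ne_zero fourierNode_injective.injOn hz) (hhalf z)
  refine ⟨fun z => (starRingEnd ℂ) (μ z) / ‖μ z‖, fun z hz => ?_, fun w hw Z hZ => ?_⟩
  · have := norm_pos_iff.mpr (hμ0 z hz)
    rw [norm_div, RCLike.norm_conj, Complex.norm_real, norm_norm, div_self this.ne']
  · set σ : Fin N → ℝ := fun z => Real.sin (Real.pi * ((((w - a : Fin N) : ℕ) : ℝ) -
      ((z - a : Fin N) : ℕ)) / N) with hσ
    set c : ℂ := (Lagrange.nodal S fourierNode).eval (fourierNode w) /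
      (fourierNode a * halfNode a w * (2 * Complex.I)) with hc
    have hσpos : ∀ z ∈ S, 0 < σ z := by
      intro z hz
      have h1 : ((z - a : Fin N) : ℕ) < n := mem_finArc.mp hz
      have h2 : n ≤ ((w - a : Fin N) : ℕ) := not_lt.mp fun h => hw (mem_finArc.mpr h)
      have h3 : (((z - a : Fin N) : ℕ) : ℝ) < ((w - a : Fin N) : ℕ) := by
        exact_mod_cast h1.trans_le h2
      have h4 : (((w - a : Fin N) : ℕ) : ℝ) < N := by exact_mod_cast (w - a).2
      have h5 : (0 : ℝ) ≤ ((z - a : Fin N) : ℕ) := Nat.cast_nonneg _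
      have hp := Real.pi_pos
      apply Real.sin_pos_of_pos_of_lt_pi
      · apply div_pos (mul_pos hp (by linarith)) hNpos
      · rw [div_lt_iff₀ hNpos]
        nlinarith
    have hval : ∀ z ∈ S, (Lagrange.basis S fourierNode z).eval (fourierNode w) =
        c * (μ z / (σ z : ℂ)) := by
      intro z hz
      have hne : fourierNode w ≠ fourierNode z :=
        fun h => hw (fourierNode_injective h ▸ hz)
      have hs : (σ z : ℂ) ≠ 0 := by exact_mod_cast (hσpos z hz).ne'
      rw [Lagrange.eval_basis_not_at_node hz hne, fourierNode_sub_eq_halfNode a w z, hc, hμ]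
      have h1 := hhalf w
      have h2 := hhalf z
      have h3 := fourierNode_ne_zero a
      have h4 := Complex.I_ne_zero
      change _ * (_ * (_ * (σ z : ℂ))⁻¹) = _
      field_simp
    have hterm : ∀ z ∈ Z, (starRingEnd ℂ) (μ z) / ‖μ z‖ *
        (Lagrange.basis S fourierNode z).eval (fourierNode w) =
        c * ((‖μ z‖ / σ z : ℝ) : ℂ) := by
      intro z hz
      have hn : (‖μ z‖ : ℂ) ≠ 0 := by
        exact_mod_cast (norm_pos_iff.mpr (hμ0 z (hZ hz))).ne'
      have hs : (σ z : ℂ) ≠ 0 := by exact_mod_cast (hσpos z (hZ hz)).ne'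
      rw [hval z (hZ hz)]
      push_cast
      have := Complex.conj_mul' (μ z)
      field_simp
      rw [← this]
      ring
    have hweight : ∀ z ∈ Z, lagrangeWeight S z w = ‖c‖ * (‖μ z‖ / σ z) := by
      intro z hz
      rw [lagrangeWeight, hval z (hZ hz), norm_mul, norm_div (μ z), Complex.norm_real,
        Real.norm_of_nonneg (hσpos z (hZ hz)).le]
    rw [Finset.sum_congr rfl hterm, Finset.sum_congr rfl hweight, ← Finset.mul_sum,
      ← Finset.mul_sum, norm_mul, ← Complex.ofReal_sum, Complex.norm_real, Real.norm_of_nonneg]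
    exact Finset.sum_nonneg fun z hz => div_nonneg (norm_nonneg _) (hσpos z (hZ hz)).le

theorem sigmaMin_sq_mul_window_le [NeZero N] (a t : Fin N) {n : ℕ} (hn0 : 0 < n) (hn : n ≤ N)
    {W Z : Finset (Fin N)} (hW : ∀ w ∈ W, w ∉ finArc a n) (hZ : Z ⊆ finArc a n)
    (hZne : Z.Nonempty) {m : ℝ} (hm : 0 ≤ m)
    (hmle : ∀ w ∈ W, ∀ z ∈ Z, m ≤ lagrangeWeight (finArc a n) z w) :
    sigmaMin (fourierSubmatrix (finArc a n) (finArc t n)) ^ 2 * (W.card * Z.card * m ^ 2) ≤ N := by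
  obtain ⟨d, hd1, hd⟩ := exists_phases_norm_sum_basis a n
  set S := finArc a n
  have hSc : S.card = n := card_finArc a hn
  -- The test polynomial has mass `|Z|` on `S`, but modulus at least `|Z| m` at every `w ∈ W`
  -- because the aligned terms add up without cancellation.
  set p : ℂ[X] := Lagrange.interpolate S fourierNode fun z => if z ∈ Z then d z else 0 with hp
  have hinj : Set.InjOn (fourierNode (N := N)) S := fourierNode_injective.injOn
  have hdeg : p.degree < n := by
    rw [← hSc]
    exact Lagrange.degree_interpolate_lt _ hinj
  obtain ⟨x, hx⟩ := exists_fourierSum_eq_eval t hn0 hn p hdeg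
  have hnorm : ∀ w, ‖fourierSum x w‖ = ‖p.eval (fourierNode w)‖ := fun w => by
    rw [hx, norm_mul, norm_pow, norm_fourierNode, one_pow, one_mul]
  have hS : ∑ z ∈ S, ‖fourierSum x z‖ ^ 2 = Z.card := by
    have h1 : ∀ z ∈ S, ‖fourierSum x z‖ ^ 2 = if z ∈ Z then 1 else 0 := by
      intro z hz
      rw [hnorm, hp, Lagrange.eval_interpolate_at_node _ hinj hz]
      split_ifs
      · rw [hd1 z hz, one_pow]
      · simp
    rw [Finset.sum_congr rfl h1, ← Finset.sum_filter, Finset.sum_const, nsmul_eq_mul, mul_one,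
      Finset.filter_mem_eq_inter, Finset.inter_eq_right.mpr hZ]
  have hWle : ∀ w ∈ W, (Z.card * m) ^ 2 ≤ ‖fourierSum x w‖ ^ 2 := by
    intro w hw
    have h1 : p.eval (fourierNode w) = ∑ z ∈ Z, d z *
        (Lagrange.basis S fourierNode z).eval (fourierNode w) := by
      rw [hp, Lagrange.interpolate_apply, eval_finsetSum, ← Finset.sum_subset hZ]
      · refine Finset.sum_congr rfl fun z hz => ?_
        rw [if_pos hz, eval_mul, eval_C]
      · intro z _ hz
        rw [if_neg hz, C_0, zero_mul, eval_zero]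
    rw [hnorm, h1, hd w (hW w hw) Z hZ]
    gcongr
    rw [← nsmul_eq_mul]
    exact Finset.card_nsmul_le_sum _ _ _ (hmle w hw)
  have hpars : W.card * (Z.card * m) ^ 2 ≤ N * ∑ k, ‖x k‖ ^ 2 := by
    rw [← sum_norm_fourierSum_sq, ← nsmul_eq_mul]
    exact (Finset.card_nsmul_le_sum _ _ _ hWle).trans
      (Finset.sum_le_sum_of_subset_of_nonneg (Finset.subset_univ W) fun _ _ _ => by positivity)
  have hσ := sigmaMin_sq_mul_le (S := S) (by rw [hSc, card_finArc t hn]) x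
  rw [hS] at hσ
  have hZpos : (0 : ℝ) < Z.card := by exact_mod_cast hZne.card_pos
  have hN0 : (0 : ℝ) ≤ N := Nat.cast_nonneg N
  refine le_of_mul_le_mul_right ?_ hZpos
  set σ := sigmaMin (fourierSubmatrix S (finArc t n))
  calc σ ^ 2 * (W.card * Z.card * m ^ 2) * Z.card = σ ^ 2 * (W.card * (Z.card * m) ^ 2) := by ring
    _ ≤ σ ^ 2 * (N * ∑ k, ‖x k‖ ^ 2) := by gcongr
    _ = N * (σ ^ 2 * ∑ k, ‖x k‖ ^ 2) := by ring
    _ ≤ N * Z.card := by gcongr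

end Phases

/-! ### Assembly of the condition number bounds. -/

section Condition

open Real

variable {N : ℕ}

theorem mul_log_two_div_two_le_catalanConstant (N : ℕ) :
    N * log 2 / 2 ≤ 2 * catalanConstant * N / π := by
  have h := log_two_div_four_le_catalanConstant_div_pi
  have e : 2 * catalanConstant * N / π = 2 * N * (catalanConstant / π) := by ring
  rw [e]
  have : (0 : ℝ) ≤ 2 * N := by positivity
  nlinarith

theorem log_condNumber_le_of_sigmaMin [NeZero N] {S T : Finset (Fin N)} {B : ℝ} (hB : 0 < B)
    (h : √(N / B) ≤ sigmaMin (fourierSubmatrix S T)) :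
    0 < sigmaMin (fourierSubmatrix S T) ∧
      0 ≤ log (condNumber (fourierSubmatrix S T)) ∧
      log (condNumber (fourierSubmatrix S T)) ≤ log B / 2 := by
  have hN : (0 : ℝ) < N := by exact_mod_cast NeZero.pos N
  have h0 : 0 < √(N / B) := sqrt_pos.mpr (div_pos hN hB)
  have hpos := h0.trans_le h
  have hle : sigmaMin (fourierSubmatrix S T) ≤ sigmaMax (fourierSubmatrix S T) :=
    LinearMap.singularValues_antitone _ (Nat.zero_le _)
  have h1 : 1 ≤ condNumber (fourierSubmatrix S T) := by
    rw [condNumber, one_le_div hpos]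
    exact hle
  refine ⟨hpos, log_nonneg h1, ?_⟩
  rw [← log_sqrt hB.le]
  apply log_le_log (by linarith)
  rw [condNumber, div_le_iff₀ hpos]
  calc sigmaMax (fourierSubmatrix S T) ≤ √N := sigmaMax_fourierSubmatrix_le S T
    _ = √B * √(N / B) := by
        rw [← sqrt_mul hB.le, mul_div_cancel₀ _ hB.ne']
    _ ≤ _ := by gcongr

theorem lagrangeWeight_sq_le [NeZero N] {S : Finset (Fin N)} {z w : Fin N} (hz : z ∈ S)
    (hw : w ∉ S) : lagrangeWeight S z w ^ 2 ≤
      16 / N ^ 2 * exp (2 * catalanConstant * N / π) ^ 2 *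
      (exp (-2 * deficiency (S.erase z) w) * exp (-2 * deficiency Sᶜ z)) := by
  have h := pow_le_pow_left₀ (norm_nonneg _) (lagrangeWeight_le hz hw) 2
  refine h.trans_eq ?_
  have e : ∀ x : ℝ, exp (-2 * x) = exp (-x) ^ 2 := fun x => by
    rw [← exp_nat_mul]
    congr 1
    push_cast
    ring
  rw [e, e]
  ring

theorem sum_lagrangeWeight_sq_le [NeZero N] (S : Finset (Fin N)) :
    ∑ w ∈ Sᶜ, ∑ z ∈ S, lagrangeWeight S z w ^ 2 ≤
      16 * exp (2 * catalanConstant * N / π) ^ 2 := by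
  have hN : (0 : ℝ) < N := by exact_mod_cast NeZero.pos N
  set E := exp (2 * catalanConstant * N / π)
  have h1 : ∀ w ∈ Sᶜ, ∀ z ∈ S, lagrangeWeight S z w ^ 2 ≤ 16 / N ^ 2 * E ^ 2 := by
    intro w hw z hz
    refine (lagrangeWeight_sq_le hz (Finset.mem_compl.mp hw)).trans ?_
    refine mul_le_of_le_one_right (by positivity) (mul_le_one₀ ?_ (exp_pos _).le ?_)
    · rw [exp_le_one_iff]
      linarith [deficiency_nonneg (S.erase z) w]
    · rw [exp_le_one_iff]
      linarith [deficiency_nonneg Sᶜ z]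
  have hc : ∀ A : Finset (Fin N), (A.card : ℝ) ≤ N := fun A => by
    exact_mod_cast A.card_le_univ.trans_eq (Fintype.card_fin N)
  calc ∑ w ∈ Sᶜ, ∑ z ∈ S, lagrangeWeight S z w ^ 2
      ≤ ∑ w ∈ Sᶜ, ∑ z ∈ S, 16 / N ^ 2 * E ^ 2 :=
        Finset.sum_le_sum fun w hw => Finset.sum_le_sum (h1 w hw)
    _ = Sᶜ.card * S.card * (16 / N ^ 2 * E ^ 2) := by
        rw [Finset.sum_const, Finset.sum_const, nsmul_eq_mul, nsmul_eq_mul, mul_assoc]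
    _ ≤ N * N * (16 / N ^ 2 * E ^ 2) := by
        gcongr
        · exact_mod_cast hc Sᶜ
        · exact_mod_cast hc S
    _ = 16 * E ^ 2 := by field_simp

/-- The complement of an arc is an arc, so the sums over `w` and over `z` each cost `20√N`; with the
prefactor `16/N²` this gives `6400/N`. -/
theorem sum_lagrangeWeight_sq_le_of_finArc [NeZero N] (a : Fin N) {n : ℕ} (hn0 : 0 < n)
    (hn : n ≤ N) : ∑ w ∈ (finArc a n)ᶜ, ∑ z ∈ finArc a n, lagrangeWeight (finArc a n) z w ^ 2 ≤
      6400 * exp (2 * catalanConstant * N / π) ^ 2 / N := by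
  have hN : (0 : ℝ) < N := by exact_mod_cast NeZero.pos N
  set E := exp (2 * catalanConstant * N / π)
  obtain ⟨b, hb⟩ := compl_finArc a hn
  rcases hn.eq_or_lt with heq | hlt
  · rw [hb, heq, Nat.sub_self]
    have : finArc b 0 = ∅ := by simp [finArc]
    rw [this, Finset.sum_empty]
    positivity
  set S := finArc a n
  have h2 : ∑ z ∈ S, exp (-2 * deficiency Sᶜ z) ≤ 20 * √N := by
    have h := sum_exp_neg_deficiency_erase_finArc_le b (Nat.sub_pos_of_lt hlt) id
    rw [← hb, compl_compl] at h
    refine le_of_eq_of_le (Finset.sum_congr rfl fun z hz => ?_) h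
    rw [id, Finset.erase_eq_of_notMem (fun h => Finset.mem_compl.mp h hz)]
  calc ∑ w ∈ Sᶜ, ∑ z ∈ S, lagrangeWeight S z w ^ 2
      ≤ ∑ w ∈ Sᶜ, ∑ z ∈ S, 16 / N ^ 2 * E ^ 2 *
          (exp (-2 * deficiency (S.erase z) w) * exp (-2 * deficiency Sᶜ z)) :=
        Finset.sum_le_sum fun w hw => Finset.sum_le_sum fun z hz =>
          lagrangeWeight_sq_le hz (Finset.mem_compl.mp hw)
    _ = 16 / N ^ 2 * E ^ 2 * ∑ z ∈ S,
          ((∑ w ∈ Sᶜ, exp (-2 * deficiency (S.erase z) w)) * exp (-2 * deficiency Sᶜ z)) := by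
        rw [Finset.sum_comm, Finset.mul_sum]
        refine Finset.sum_congr rfl fun z _ => ?_
        rw [Finset.sum_mul, Finset.mul_sum]
    _ ≤ 16 / N ^ 2 * E ^ 2 * ∑ z ∈ S, ((20 * √N) * exp (-2 * deficiency Sᶜ z)) := by
        gcongr with z hz
        exact sum_exp_neg_deficiency_erase_finArc_le a hn0 fun _ => z
    _ = 16 / N ^ 2 * E ^ 2 * ((20 * √N) * ∑ z ∈ S, exp (-2 * deficiency Sᶜ z)) := by
        rw [← Finset.mul_sum]
    _ ≤ 16 / N ^ 2 * E ^ 2 * ((20 * √N) * (20 * √N)) := by gcongr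
    _ = 16 / N ^ 2 * E ^ 2 * (400 * √N ^ 2) := by ring
    _ = 6400 * E ^ 2 / N := by
        rw [sq_sqrt hN.le]
        field_simp
        ring

theorem exists_window_deficiency_le [NeZero N] (hN : 324 ≤ N) (a : Fin N) {n : ℕ}
    (hn : |(n : ℝ) - N / 2| ≤ 1) : ∃ W : Finset (Fin N), √N ≤ W.card ∧
      ∀ w ∈ W, w ∉ finArc a n ∧ deficiency (finArc a n) w ≤ 160 := by
  have hN' : (324 : ℝ) ≤ N := by exact_mod_cast hN
  have hs : 18 ≤ √(N : ℝ) := by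
    rw [le_sqrt (by norm_num) (by linarith)]
    linarith
  have hss : √(N : ℝ) ^ 2 = N := sq_sqrt (by linarith)
  rw [abs_le] at hn
  -- This is `R ≤ N/16` for `R = √N + 2`, the radius used below; it is the reason for the threshold
  -- `324 = 18²`.
  have hsN : 16 * √N + 32 ≤ N := by nlinarith
  set q : ℝ := N / 4 + √N + 1 with hq
  refine ⟨Finset.univ.filter fun w : Fin N =>
    (N / 4 : ℝ) ≤ ((a - w : Fin N) : ℕ) ∧ (((a - w : Fin N) : ℕ) : ℝ) < q, ?_, fun w hw => ?_⟩
  · rw [Fin.card_filter_sub_val (fun l => (N / 4 : ℝ) ≤ l ∧ (l : ℝ) < q)]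
    have := le_card_filter_range (N := N) (p := N / 4) (q := q) (by linarith) (by positivity)
    linarith
  · obtain ⟨-, h1, h2⟩ := Finset.mem_filter.mp hw
    have hw' : w ∉ finArc a n := by
      have h3 : (((a - w : Fin N) : ℕ) : ℝ) + n < N := by linarith
      have h3' : ((a - w : Fin N) : ℕ) + n < N := by exact_mod_cast h3
      have h4 : (0 : ℝ) < ((a - w : Fin N) : ℕ) := by linarith
      have h4' : 0 < ((a - w : Fin N) : ℕ) := by exact_mod_cast h4
      rw [mem_finArc]
      rcases Fin.val_sub_cases a w with ⟨h5, h6⟩ | ⟨h5, h6⟩ <;>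
      rcases Fin.val_sub_cases w a with ⟨h7, h8⟩ | ⟨h7, h8⟩ <;> omega
    refine ⟨hw', ?_⟩
    refine (deficiency_finArc_le hw' (R := √N + 2) (by linarith) ?_ ?_).trans ?_
    · rw [abs_le]
      constructor <;> linarith
    · rw [abs_le]
      constructor <;> linarith
    · rw [← mul_div_assoc, div_le_iff₀ (by linarith)]
      nlinarith

theorem le_log_condNumber_of_finArc [NeZero N] (hN : 324 ≤ N) (a t : Fin N) {n : ℕ}
    (hn : |(n : ℝ) - N / 2| ≤ 1) (hnN : (N : ℝ) / 2 ≤ n)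
    (hpos : 0 < sigmaMin (fourierSubmatrix (finArc a n) (finArc t n))) :
    2 * catalanConstant * N / π - 1 / 2 * log N - 330 ≤
      log (condNumber (fourierSubmatrix (finArc a n) (finArc t n))) := by
  have hN' : (324 : ℝ) ≤ N := by exact_mod_cast hN
  have hn2 := abs_le.mp hn
  have hn0 : 0 < n := by
    have : (0 : ℝ) < n := by linarith
    exact_mod_cast this
  have hnle : n ≤ N := by
    have : (n : ℝ) ≤ N := by linarith
    exact_mod_cast this
  obtain ⟨b, hb⟩ := compl_finArc a hnle
  obtain ⟨W, hWc, hW⟩ := exists_window_deficiency_le hN a hn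
  obtain ⟨Z, hZc, hZ⟩ := exists_window_deficiency_le hN b (n := N - n) (by
    rw [Nat.cast_sub hnle, abs_le]
    constructor <;> linarith)
  rw [← hb] at hZ
  set S := finArc a n with hS
  set E := exp (2 * catalanConstant * N / π) with hE
  set m : ℝ := 1 / (8 * N) * E * (exp (-160) * exp (-160)) with hm
  have hZS : Z ⊆ S := fun z hz => by
    have := (hZ z hz).1
    rwa [Finset.mem_compl, not_not] at this
  have hs : 0 < √(N : ℝ) := sqrt_pos.mpr (by linarith)
  have hZne : Z.Nonempty := by
    rw [← Finset.card_pos]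
    have : (0 : ℝ) < Z.card := hs.trans_le hZc
    exact_mod_cast this
  have hmpos : 0 < m := by positivity
  have hmle : ∀ w ∈ W, ∀ z ∈ Z, m ≤ lagrangeWeight S z w := by
    intro w hw z hz
    refine le_trans ?_ (le_lagrangeWeight (hZS hz) (hW w hw).1)
    rw [hm]
    gcongr
    · exact (hW w hw).2
    · exact (hZ z hz).2
  have h1 := sigmaMin_sq_mul_window_le a t hn0 hnle (fun w hw => (hW w hw).1) hZS hZne
    hmpos.le hmle
  have h2 : √n ≤ sigmaMax (fourierSubmatrix S (finArc t n)) := by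
    have := sqrt_card_le_sigmaMax (S := S) (T := finArc t n) (by
      rw [← Finset.card_pos, hS, card_finArc a hnle]
      exact hn0)
    rwa [card_finArc t hnle] at this
  set σ := sigmaMin (fourierSubmatrix S (finArc t n))
  have h3 : σ ^ 2 * (N * m ^ 2) ≤ N := by
    refine le_trans ?_ h1
    have : (N : ℝ) ≤ W.card * Z.card := by
      calc (N : ℝ) = √N * √N := (mul_self_sqrt (by linarith)).symm
        _ ≤ _ := by gcongr
    gcongr
  have h4 : σ * m ≤ 1 := by
    have h5 : (σ * m) ^ 2 ≤ 1 := by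
      have : N * (σ * m) ^ 2 ≤ N * 1 := by linarith [mul_pow σ m 2]
      exact le_of_mul_le_mul_left this (by linarith)
    exact (sq_le_one_iff₀ (by positivity)).mp h5
  have h5 : √n * m ≤ condNumber (fourierSubmatrix S (finArc t n)) := by
    rw [condNumber, le_div_iff₀ hpos]
    calc √n * m * σ = √n * (σ * m) := by ring
      _ ≤ √n * 1 := by gcongr
      _ ≤ _ := by rw [mul_one]; exact h2
  have hn0' : (0 : ℝ) < n := by exact_mod_cast hn0
  have h6 := log_le_log (by positivity) h5
  rw [log_mul (by positivity) hmpos.ne', log_sqrt hn0'.le, hm, log_mul (by positivity) (by positivity),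
    log_mul (by positivity) (by positivity), ← exp_add, log_exp, log_exp, one_div, log_inv,
    log_mul (by norm_num) (by positivity), show (8 : ℝ) = 2 ^ 3 by norm_num, log_pow] at h6
  have h7 := log_le_log (by positivity) hnN
  rw [log_div (by positivity) two_ne_zero] at h7
  have h8 := log_two_lt_d9
  push_cast at h6
  linarith

theorem corollary1p3 :
    ∃ C : ℝ, ∀ (N : ℕ) (S T : Finset (Fin N)), S.Nonempty → T.Nonempty →
      IsCyclicallyContiguous T →
      0 < sigmaMin (fourierSubmatrix S T) ∧
      Real.log (condNumber (fourierSubmatrix S T)) ≤ 2 * catalanConstant * N / Real.pi + C ∧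
      (IsCyclicallyContiguous S →
        Real.log (condNumber (fourierSubmatrix S T)) ≤
          2 * catalanConstant * N / Real.pi - (1 / 2) * Real.log N + C ∧
        (S.card = ⌈(N : ℝ) / 2⌉₊ → T.card = ⌈(N : ℝ) / 2⌉₊ →
          |Real.log (condNumber (fourierSubmatrix S T)) -
            (2 * catalanConstant * N / Real.pi - (1 / 2) * Real.log N)| ≤ C)) := by
  have hG : 0 ≤ catalanConstant / π :=
    le_trans (by have := log_pos one_lt_two; positivity) log_two_div_four_le_catalanConstant_div_pi
  refine ⟨7000 + 648 * (catalanConstant / π), fun N S T hS hT hTc => ?_⟩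
  obtain ⟨s0, hs0⟩ := hS
  have : NeZero N := ⟨by have := s0.2; omega⟩
  have hNpos : (0 : ℝ) < N := by exact_mod_cast NeZero.pos N
  have hN1 : (1 : ℝ) ≤ N := by exact_mod_cast NeZero.pos N
  set E := exp (2 * catalanConstant * N / π) with hE
  have hE1 : 1 ≤ E ^ 2 := by
    have h := mul_log_two_div_two_le_catalanConstant N
    have : 0 ≤ 2 * catalanConstant * N / π :=
      le_trans (by have := log_pos one_lt_two; positivity) h
    exact one_le_pow₀ (one_le_exp this)
  -- Absorbs the `1` in front of the double sum, turning `6400` into `6402` in the arc case.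
  have hEN : 1 ≤ 2 * E ^ 2 / N := by
    have h := mul_log_two_div_two_le_catalanConstant N
    rw [le_div_iff₀ hNpos, one_mul, hE, ← exp_nat_mul]
    have h1 := add_one_le_exp ((2 : ℕ) * (2 * catalanConstant * N / π))
    push_cast at h1 ⊢
    nlinarith [log_two_gt_d9]
  set n := min S.card T.card with hn
  have hn0 : 0 < n := lt_min (Finset.card_pos.mpr ⟨s0, hs0⟩) (Finset.card_pos.mpr hT)
  have hnN : n ≤ N := (min_le_left _ _).trans (S.card_le_univ.trans_eq (Fintype.card_fin N))
  obtain ⟨t, ht⟩ := hTc.exists_eq_finArc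
  have hT' : finArc t n ⊆ T := by
    rw [ht]
    exact finArc_mono t (min_le_right _ _)
  have hmain : ∀ S' ⊆ S, S'.card = n → ∀ B : ℝ,
      1 + ∑ w ∈ S'ᶜ, ∑ z ∈ S', lagrangeWeight S' z w ^ 2 ≤ B →
      √(N / B) ≤ sigmaMin (fourierSubmatrix S T) := by
    intro S' hS' hS'c B hB
    have h0 : 0 ≤ ∑ w ∈ S'ᶜ, ∑ z ∈ S', lagrangeWeight S' z w ^ 2 :=
      Finset.sum_nonneg fun _ _ => Finset.sum_nonneg fun _ _ => sq_nonneg _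
    refine sqrt_div_le_sigmaMin hS' hT' (card_finArc t hnN) (by rwa [card_finArc t hnN])
      (by linarith) fun x => ?_
    clear_value n
    subst hS'c
    refine (card_mul_sum_norm_sq_le x).trans ?_
    gcongr
  obtain ⟨S₁, hS₁, hS₁c⟩ := Finset.exists_subset_card_eq (min_le_left S.card T.card)
  obtain ⟨hpos, hlog0, hlog⟩ := log_condNumber_le_of_sigmaMin (B := 17 * E ^ 2) (by positivity)
    (hmain S₁ hS₁ hS₁c _ (by linarith [sum_lagrangeWeight_sq_le S₁]))
  refine ⟨hpos, ?_, fun hSc => ?_⟩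
  · rw [log_mul (by norm_num) (by positivity), log_pow, hE, log_exp] at hlog
    have := log_le_sub_one_of_pos (x := 17) (by norm_num)
    push_cast at hlog
    linarith
  · obtain ⟨a, ha⟩ := hSc.exists_eq_finArc
    have hub : log (condNumber (fourierSubmatrix S T)) ≤
        2 * catalanConstant * N / π - 1 / 2 * log N + (7000 + 648 * (catalanConstant / π)) := by
      obtain ⟨-, -, h⟩ := log_condNumber_le_of_sigmaMin (B := 6402 * E ^ 2 / N) (by positivity)
        (hmain (finArc a n) (by rw [ha]; exact finArc_mono a (min_le_left _ _))
          (card_finArc a hnN) _ (by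
            have h1 := sum_lagrangeWeight_sq_le_of_finArc a hn0 hnN
            have e : 6402 * E ^ 2 / N = 2 * E ^ 2 / N + 6400 * E ^ 2 / N := by ring
            rw [e]
            linarith))
      rw [log_div (by positivity) (by positivity), log_mul (by norm_num) (by positivity), log_pow,
        hE, log_exp] at h
      have := log_le_sub_one_of_pos (x := 6402) (by norm_num)
      push_cast at h
      linarith
    refine ⟨hub, fun hSn hTn => ?_⟩
    rw [abs_le]
    refine ⟨?_, by linarith⟩
    -- For small `N` the bound `log κ ≥ 0` suffices, since `2GN/π ≤ 648 G/π` is part of the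
    -- constant.
    rcases lt_or_ge N 324 with hlt | hge
    · have hlogN := log_nonneg hN1
      have e : 2 * catalanConstant * N / π = 2 * N * (catalanConstant / π) := by ring
      have hlt' : (N : ℝ) ≤ 324 := by exact_mod_cast hlt.le
      rw [e]
      nlinarith
    · rw [hSn] at ha
      rw [hTn] at ht
      have hc1 := Nat.le_ceil ((N : ℝ) / 2)
      have hc2 := Nat.ceil_lt_add_one (a := (N : ℝ) / 2) (by positivity)
      subst ha ht
      have := le_log_condNumber_of_finArc hge a t (n := ⌈(N : ℝ) / 2⌉₊)
        (by rw [abs_le]; constructor <;> linarith) hc1 hpos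
      linarith

end Condition
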